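/- Let $\mathcal A$ be a semi-abelian category (pointed, Barr exact, Bourn protomodular, with binary coproducts) and $\mathcal B$ a Birkhoff subcategory of $\mathcal A$ (full, reflective, closed under subobjects and regular quotients). **Higher extensions.** Put $\mathrm{Arr}^0\mathcal A=\mathcal A$ and let $\mathrm{Arr}^{n+1}\mathcal A$ be the category of arrows of $\mathrm{Arr}^n\mathcal A$. Every object of $\mathcal A$ is a $0$-extension, and a $1$-extension is a regular epimorphism of $\mathcal A$. For $n\ge 2$, an $n$-extension is an object of $\mathrm{Arr}^n\mathcal A$, i.e. a commutative square $$\begin{array}{ccc}B_0&\xrightarrow{f_0}&A_0\\ {\scriptstyle b}\downarrow&&\downarrow{\scriptstyle a}\\ B&\xrightarrow{f}&A\end{array}$$ in $\mathrm{Arr}^{n-2}\mathcal A$, such that $f_0$, $f$, $a$, $b$, the two projections of the pullback $B\times_A A_0$ and the comparison morphism $B_0\to B\times_A A_0$ are all $(n-1)$-extensions. Let $\mathrm{Ext}^n\mathcal A$ be the full subcategory of $\mathrm{Arr}^n\mathcal A$ on the $n$-extensions, and $\mathcal E^n$ the class of morphisms of $\mathrm{Ext}^n\mathcal A$ that are $(n+1)$-extensions.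 **Trivial, central and normal extensions.** Let $\mathcal P$ be a full reflective subcategory of a category $\mathcal X$, with reflector $I$ and unit $\eta$, and let $\mathcal E$ be a class of morphisms of $\mathcal X$. A morphism $f\colon X\to Y$ in $\mathcal E$ is *trivial* if the naturality square of $\eta$ at $f$ (with sides $\eta_X$, $f$, $If$, $\eta_Y$) is a pullback; it is *central* if there is $a\colon Y_0\to Y$ in $\mathcal E$ such that the pullback $a^*f$ of $f$ along $a$ exists and is trivial; it is *normal* if it has a kernel pair whose first projection is trivial. **The structures $\Gamma_n$.** Let $\Gamma_0$ consist of $\mathcal A$, the subcategory $\mathcal B$ and the class of regular epimorphisms. Let $\mathrm{CExt}^1_{\mathcal B}\mathcal A$ be the full subcategory of $\mathrm{Ext}^1\mathcal A$ on the extensions that are central with respect to $\Gamma_0$. For $n\ge 1$, let $\Gamma_n$ consist of the category $\mathrm{Ext}^n\mathcal A$, the subcategory $\mathrm{CExt}^n_{\mathcal B}\mathcal A$ with its reflector $I_n$, and the class $\mathcal E^n$; and let $\mathrm{CExt}^{n+1}_{\mathcal B}\mathcal A$ be the full subcategory of $\mathrm{Ext}^{n+1}\mathcal A$ on the extensions that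 are normal with respect to $\Gamma_n$. **Proposition.** For every $n\ge 1$, $\mathrm{CExt}^n_{\mathcal B}\mathcal A$ is reflective in $\mathrm{Ext}^n\mathcal A$ (so that $\Gamma_n$ is defined), and: 1. A morphism of $\mathrm{Ext}^n\mathcal A$ is a central extension with respect to $\Gamma_n$ if and only if it is a normal extension with respect to $\Gamma_n$. Hence the objects of $\mathrm{CExt}^{n+1}_{\mathcal B}\mathcal A$ are exactly the extensions that are central with respect to $\Gamma_n$. 2. Every extension that is central with respect to $\Gamma_n$ and is a split epimorphism in $\mathrm{Ext}^n\mathcal A$ is trivial with respect to $\Gamma_n$. -/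

import Mathlib

open CategoryTheory Limits

universe w u v

namespace HigherCentral

/-! ### Semi-abelian categories and Birkhoff subcategories -/

section SemiAbelian

variable {C : Type u} [Category.{v} C]

/-- `k : K ⟶ B` is a kernel of `f : B ⟶ A`: it is a pullback of `0 ⟶ A` along `f`. -/
def IsKernelOf {K B A : C} (k : K ⟶ B) (f : B ⟶ A) : Prop :=
  ∃ (Z : C) (hZ : IsZero Z), IsPullback k (hZ.from_ K) f (hZ.to_ A)

variable (C) in
/-- A semi-abelian category: pointed, Barr exact (regular, and every internal equivalence relation
is a kernel pair), Bourn protomodular, and with binary coproducts. In this pointed regular context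
Bourn protomodularity is expressed by the (regular) Short Five Lemma. -/
class SemiAbelian : Prop where
  /-- the category is regular -/
  regular : Regular C
  /-- the category is pointed -/
  hasZeroObject : HasZeroObject C
  /-- binary coproducts exist -/
  hasBinaryCoproducts : HasBinaryCoproducts C
  /-- every internal equivalence relation is a kernel pair -/
  exists_isKernelPair : ∀ {R X : C} (p₁ p₂ : R ⟶ X), IsEquivalenceRelation p₁ p₂ →
    ∃ (Y : C) (f : X ⟶ Y), IsKernelPair f p₁ p₂
  /-- the Short Five Lemma -/
  shortFive : ∀ {K₀ B₀ A₀ K B A : C} (k₀ : K₀ ⟶ B₀) (f₀ : B₀ ⟶ A₀) (k : K ⟶ B) (f : B ⟶ A)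
    (κ : K₀ ⟶ K) (b : B₀ ⟶ B) (a : A₀ ⟶ A),
    IsRegularEpi f₀ → IsRegularEpi f → IsKernelOf k₀ f₀ → IsKernelOf k f →
    k₀ ≫ b = κ ≫ k → f₀ ≫ a = b ≫ f → IsIso κ → IsIso a → IsIso b

/-- A Birkhoff subcategory: a full reflective subcategory closed under subobjects and under
regular quotients (so, in particular, replete). -/
structure IsBirkhoff (B : ObjectProperty C) : Prop where
  /-- the inclusion has a left adjoint -/
  isRightAdjoint : B.ι.IsRightAdjoint
  /-- closure under subobjects -/
  of_mono : ∀ {X Y : C} (i : X ⟶ Y), Mono i → B Y → B X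
  /-- closure under regular quotients -/
  of_regularEpi : ∀ {X Y : C} (q : X ⟶ Y), IsRegularEpi q → B X → B Y

end SemiAbelian

/-! ### Trivial, central and normal extensions

In a Galois structure given by a category `C`, a full reflective subcategory `P` of `C` (with
reflector `I` and unit `η`) and a class `E` of morphisms of `C`, called extensions. -/

section Galois

variable {C : Type u} [Category.{v} C] (P : ObjectProperty C) (E : MorphismProperty C)

/-- An extension `f : X ⟶ Y` is trivial when the naturality square of the unit `η` of the
reflection at `f` is a pullback. (The reflector is unique up to isomorphism, so the choice of
it is irrelevant.) -/
def IsTrivialExt {X Y : C} (f : X ⟶ Y) : Prop :=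
  E f ∧ ∃ _ : Reflective P.ι,
    IsPullback ((reflectorAdjunction P.ι).unit.app X) f
      (P.ι.map ((reflector P.ι).map f)) ((reflectorAdjunction P.ι).unit.app Y)

/-- An extension `f : X ⟶ Y` is central when its pullback `a^* f` along some extension
`a : Y₀ ⟶ Y` is trivial. -/
def IsCentralExt {X Y : C} (f : X ⟶ Y) : Prop :=
  E f ∧ ∃ (Y₀ X₀ : C) (a : Y₀ ⟶ Y) (f₀ : X₀ ⟶ Y₀) (x : X₀ ⟶ X),
    E a ∧ IsPullback x f₀ f a ∧ IsTrivialExt P E f₀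

/-- An extension is normal when the first projection of its kernel pair is a trivial extension. -/
def IsNormalExt {X Y : C} (f : X ⟶ Y) : Prop :=
  E f ∧ ∃ (R : C) (π₁ π₂ : R ⟶ X), IsKernelPair f π₁ π₂ ∧ IsTrivialExt P E π₁

end Galois

/-! ### Higher extensions and higher central extensions -/

/-- Given a class `W` of arrows of `C`, the class of those morphisms `φ : b ⟶ a` of arrows of `C`,
that is, commutative squares
```
  B₀ --f₀--> A₀
  |          |
  b          a
  v          v
  B  --f-->  A
```
such that `f₀`, `f`, `b`, `a`, the two projections of the pullback `B ×_A A₀` and the comparison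
morphism `B₀ ⟶ B ×_A A₀` are all in `W`. -/
def squareExt {C : Type u} [Category.{v} C] (W : MorphismProperty C) :
    MorphismProperty (Arrow C) := fun b a φ =>
  W φ.left ∧ W φ.right ∧ W b.hom ∧ W a.hom ∧
    ∃ (Q : C) (p : Q ⟶ a.left) (q : Q ⟶ b.right) (h : IsPullback p q a.hom φ.right),
      W p ∧ W q ∧ W (h.lift φ.left b.hom φ.w)

/-- The data, at some stage `n`, from which the Galois structure `Γ_n` is formed. -/
structure Level where
  /-- the category `Arr^n A` of `n`-fold arrows -/
  Arr : Type w
  /-- the category structure of `Arr^n A` -/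
  [category : Category.{v} Arr]
  /-- the objects of `Arr^n A` that are `n`-fold extensions -/
  isExt : ObjectProperty Arr
  /-- the class `E^n` of `(n+1)`-fold extensions, as a class of morphisms of `Arr^n A` -/
  isSuccExt : MorphismProperty Arr
  /-- the objects of `Arr^n A` that belong to `CExt^n_B A` -/
  isCExt : ObjectProperty Arr

attribute [instance] Level.category

namespace Level

/-- The category `Ext^n A`, a full subcategory of `Arr^n A`. -/
abbrev Ext (L : Level.{w, v}) : Type w := L.isExt.FullSubcategory

/-- `CExt^n_B A` as a full subcategory of `Ext^n A`. -/
def cExt (L : Level.{w, v}) : ObjectProperty L.Ext := L.isCExt.inverseImage L.isExt.ι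

/-- The class `E^n` of extensions of the Galois structure `Γ_n` on `Ext^n A`. -/
def E (L : Level.{w, v}) : MorphismProperty L.Ext := L.isSuccExt.inverseImage L.isExt.ι

/-- Trivial extensions with respect to `Γ_n`. -/
def IsTrivial (L : Level.{w, v}) {X Y : L.Ext} (f : X ⟶ Y) : Prop := IsTrivialExt L.cExt L.E f

/-- Central extensions with respect to `Γ_n`. -/
def IsCentral (L : Level.{w, v}) {X Y : L.Ext} (f : X ⟶ Y) : Prop := IsCentralExt L.cExt L.E f

/-- Normal extensions with respect to `Γ_n`. -/
def IsNormal (L : Level.{w, v}) {X Y : L.Ext} (f : X ⟶ Y) : Prop := IsNormalExt L.cExt L.E f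

/-- The first stage: `Arr A` is the category of arrows of `A`, a `1`-fold extension is a regular
epimorphism of `A`, and `CExt^1_B A` consists of the extensions which are central with respect to
the Galois structure `Γ_0` given by the regular epimorphisms of `A` and the subcategory `B`. -/
def first {A : Type u} [Category.{v} A] (B : ObjectProperty A) : Level.{max u v, v} where
  Arr := Arrow A
  isExt := fun f => IsRegularEpi f.hom
  isSuccExt := squareExt (MorphismProperty.regularEpi A)
  isCExt := fun f => IsCentralExt B (MorphismProperty.regularEpi A) f.hom

/-- From stage `n` to stage `n + 1`: `Arr^{n+1} A` is the category of arrows of `Arr^n A`, and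
`CExt^{n+1}_B A` consists of the extensions which are normal with respect to `Γ_n`. -/
def next (L : Level.{max u v, v}) : Level.{max u v, v} where
  Arr := Arrow L.Arr
  isExt := fun f => L.isSuccExt f.hom
  isSuccExt := squareExt L.isSuccExt
  isCExt := fun f => ∃ (hl : L.isExt f.left) (hr : L.isExt f.right),
    L.IsNormal (X := ⟨f.left, hl⟩) (Y := ⟨f.right, hr⟩) (ObjectProperty.homMk f.hom)

end Level

/-- The tower of Galois structures: `level B m` is the stage `n = m + 1`, so that `level B 0`
carries `Γ_1`, `level B 1` carries `Γ_2`, and so on. -/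
def level {A : Type u} [Category.{v} A] (B : ObjectProperty A) : ℕ → Level.{max u v, v}
  | 0 => Level.first B
  | m + 1 => (level B m).next

end HigherCentral

/-!
# Higher central extensions in semi-abelian categories

The proof is an induction along the tower, of an invariant with two parts. The first part,
`ExtClass`, lists properties of a class of extensions which pass to double extensions
(`ExtClass.squareExt`): stability under composition and pullback, right cancellation, descent,
effectiveness of reflexive relations, and the Mal'tsev property that a square of split epimorphisms
between extensions is a double extension. The second part, `StronglyBirkhoff`, says that the
subcategory is reflective and that the naturality squares of its unit at extensions are double
extensions.

Under these hypotheses the proposition is proved as follows. For a split extension `π : R ⟶ X`,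
let `t : R ⟶ T` be the comparison of `π` with the pullback of its reflection along the unit; thus
`π` is trivial if and only if `t` is invertible. By the Mal'tsev property, `t` is natural up to a
double extension with respect to extensions between split extensions
(`Trivialization.naturality`). All else follows from this.
* If `f` has a trivial pullback along an extension, then the projection `π` of its kernel pair `R`
  is covered by a trivial extension `π₀ : R₀ ⟶ X₀`. By naturality `t` pulls back to an isomorphism
  along an extension, so it is an isomorphism and `f` is normal (`normalExt_of_isPullback`).
* A split epimorphism is a pullback, along its section, of the projection of its kernel pair; since
  trivial extensions are stable under pullback, it is trivial if it is normal
  (`NormalExt.trivialExt_of_section`).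
* The reflection of an extension `f : X ⟶ Y` among the normal extensions is the quotient of `X` by
  the equivalence relation of the pairs `(x, y)` in the kernel pair with `t (x, y) = t (x, x)`.
  Naturality of `t` shows that this quotient is normal, and that the units of this reflection form
  double extensions between extensions: the normal extensions are again strongly Birkhoff
  (`StronglyBirkhoff.normalExt`), and the induction goes on.

The induction starts with the regular epimorphisms of a semi-abelian category. There the Mal'tsev
property comes from the Short Five Lemma, in the form that all relations are difunctional
(`difunctional`), and Birkhoff subcategories are strongly Birkhoff
(`IsBirkhoff.stronglyBirkhoff`).
-/

namespace HigherCentral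

/-! ### Classes of extensions -/

section ExtClass

variable {C : Type u} [Category.{v} C]

/-- The properties of a class `W` of extensions in a category `C` which pass from `W` to the class
`squareExt W` of double extensions. The objects of interest are those in `D`: all extensions live
between such objects, and extensions are pulled back along arbitrary morphisms between them.
The field `split` is a relative form of the Mal'tsev property, and `exists_quotient` of Barr
exactness: it says that reflexive relations are effective. -/
structure ExtClass (D : ObjectProperty C) (W : MorphismProperty C) : Prop where
  source : ∀ {X Y : C} {f : X ⟶ Y}, W f → D X
  target : ∀ {X Y : C} {f : X ⟶ Y}, W f → D Y
  of_isIso : ∀ {X Y : C} (f : X ⟶ Y), D X → IsIso f → W f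
  comp : ∀ {X Y Z : C} {f : X ⟶ Y} {g : Y ⟶ Z}, W f → W g → W (f ≫ g)
  cancel : ∀ {X Y Z : C} {f : X ⟶ Y} {g : Y ⟶ Z}, W f → W (f ≫ g) → W g
  of_isPullback : ∀ {P X Y₀ Y : C} {x : P ⟶ X} {f₀ : P ⟶ Y₀} {f : X ⟶ Y} {y : Y₀ ⟶ Y},
    IsPullback x f₀ f y → W f → D Y₀ → W f₀
  zero : ∀ {Z : C}, IsZero Z → D Z
  epi : ∀ {X Y : C} {f : X ⟶ Y}, W f → Epi f
  /-- extensions are the quotients of their kernel pairs -/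
  exists_desc : ∀ {X Y Z : C} {f : X ⟶ Y} (g : X ⟶ Z), W f →
    (∀ {T : C} (s t : T ⟶ X), s ≫ f = t ≫ f → s ≫ g = t ≫ g) → ∃ h : Y ⟶ Z, f ≫ h = g
  /-- a square of split epimorphisms, with compatible sections, between extensions
  is a double extension -/
  split : ∀ {B₀ A₀ B A Q : C} {f₀ : B₀ ⟶ A₀} {f : B ⟶ A} {b : B₀ ⟶ B} {a : A₀ ⟶ A}
    {s₀ : A₀ ⟶ B₀} {s : A ⟶ B} {p : Q ⟶ A₀} {q : Q ⟶ B} {l : B₀ ⟶ Q},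
    W f₀ → W b → W a → f₀ ≫ a = b ≫ f → s₀ ≫ b = a ≫ s → s₀ ≫ f₀ = 𝟙 _ → s ≫ f = 𝟙 _ →
    IsPullback p q a f → l ≫ p = f₀ → l ≫ q = b → W l
  /-- reflexive relations are kernel pairs of extensions -/
  exists_quotient : ∀ {S X : C} {p₁ p₂ : S ⟶ X} (d : X ⟶ S), d ≫ p₁ = 𝟙 _ → d ≫ p₂ = 𝟙 _ →
    (∀ {T : C} (s t : T ⟶ S), s ≫ p₁ = t ≫ p₁ → s ≫ p₂ = t ≫ p₂ → s = t) → W p₁ →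
    ∃ (Y : C) (q : X ⟶ Y), W q ∧ IsPullback p₁ p₂ q q
  isIso_of_kernel : ∀ {K X Y : C} {k : K ⟶ X} {f : X ⟶ Y}, W f → IsKernelOf k f → IsZero K →
    IsIso f

variable {D : ObjectProperty C} {W : MorphismProperty C}

lemma ExtClass.isIso_of_split_mono (H : ExtClass D W) {X Y : C} {f : X ⟶ Y} (hf : W f)
    (g : Y ⟶ X) (h : f ≫ g = 𝟙 X) : IsIso f := by
  have := H.epi hf
  exact ⟨g, h, by rw [← cancel_epi f, reassoc_of% h, Category.comp_id]⟩

lemma squareExt_mk (H : ExtClass D W) {b a : Arrow C} {φ : b ⟶ a} (hl : W φ.left) (hr : W φ.right)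
    (hb : W b.hom) {Q : C} {p : Q ⟶ a.left} {q : Q ⟶ b.right} (h : IsPullback p q a.hom φ.right)
    {l : b.left ⟶ Q} (h₁ : l ≫ p = φ.left) (h₂ : l ≫ q = b.hom) (hW : W l) : squareExt W φ := by
  have ha : W a.hom := H.cancel hl (by rw [Arrow.w φ]; exact H.comp hb hr)
  refine ⟨hl, hr, hb, ha, Q, p, q, h, H.of_isPullback h.flip hr (H.source ha),
    H.of_isPullback h ha (H.source hr), ?_⟩
  convert! hW
  exact h.hom_ext (by simp [h₁]) (by simp [h₂])

lemma squareExt_comparison (H : ExtClass D W) {b a : Arrow C} {φ : b ⟶ a} (hφ : squareExt W φ)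
    {Q : C} {p : Q ⟶ a.left} {q : Q ⟶ b.right} (h : IsPullback p q a.hom φ.right)
    {l : b.left ⟶ Q} (h₁ : l ≫ p = φ.left) (h₂ : l ≫ q = b.hom) : W l := by
  obtain ⟨-, -, -, -, Q', p', q', h', -, -, hW⟩ := hφ
  have e : l = h'.lift φ.left b.hom φ.w ≫ (h'.isoIsPullback _ _ h).hom :=
    h.hom_ext (by simp [h₁]) (by simp [h₂])
  rw [e]
  exact H.comp hW (H.of_isIso _ (H.target hW) inferInstance)

/-- A square between extensions whose lower edge is invertible is a double extension as soon as
its upper edge is an extension. -/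
lemma squareExt_of_isIso_right (H : ExtClass D W) {b a : Arrow C} {φ : b ⟶ a} (hl : W φ.left)
    [IsIso φ.right] (hb : W b.hom) : squareExt W φ := by
  refine squareExt_mk H hl (H.of_isIso _ (H.target hb) inferInstance) hb
    (p := 𝟙 _) (q := a.hom ≫ inv φ.right) (IsPullback.of_horiz_isIso ⟨by simp⟩)
    (l := φ.left) (by simp) (by simp) hl

/-- Being an extension is a local property: a morphism `l : X ⟶ Q` over `Y`, whose structure
morphism `q : X ⟶ Y` is an extension, is an extension if its pullback `m` along `q` is one. The
domain of this pullback is the kernel pair `S` of `q`. -/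
lemma ExtClass.of_kernelPair (H : ExtClass D W) {S X Y Q G : C} {p₁ p₂ : S ⟶ X} {q : X ⟶ Y}
    (hq : W q) (hS : IsPullback p₁ p₂ q q) {p : Q ⟶ Y} (hQ : D Q) {g₁ : G ⟶ X} {g₂ : G ⟶ Q}
    (hG : IsPullback g₁ g₂ q p) {l : X ⟶ Q} {m : S ⟶ G} (hm : W m)
    (h₂ : m ≫ g₂ = p₂ ≫ l) : W l := by
  have h := H.of_isPullback hG hq hQ
  have h' := H.of_isPullback hS hq (H.source hq)
  exact H.cancel h' (by rw [← h₂]; exact H.comp hm h)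

end ExtClass

/-! ### Pullbacks of arrows -/

section Arrow

variable {C : Type u} [Category.{v} C]

/-- The morphism from the identity arrow of `T` determined by `s : T ⟶ P.left`. -/
def ofLeft {T : C} {P : Arrow C} (s : T ⟶ P.left) : Arrow.mk (𝟙 T) ⟶ P :=
  Arrow.homMk s (s ≫ P.hom) (by simp)

lemma ofLeft_comp {T : C} {P X : Arrow C} (s : T ⟶ P.left) (p : P ⟶ X) :
    ofLeft s ≫ p = ofLeft (s ≫ p.left) := by
  ext <;> simp [ofLeft]

lemma ofLeft_injective {T : C} {P : Arrow C} {s t : T ⟶ P.left} (h : ofLeft s = ofLeft t) :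
    s = t := congr_arg CommaMorphism.left h

/-- The morphism from the arrow `⊥_ C ⟶ T` determined by `s : T ⟶ P.right`. -/
noncomputable def ofRight [HasInitial C] {T : C} {P : Arrow C} (s : T ⟶ P.right) :
    Arrow.mk (initial.to T) ⟶ P :=
  Arrow.homMk (initial.to _) s (by simp)

lemma ofRight_comp [HasInitial C] {T : C} {P X : Arrow C} (s : T ⟶ P.right) (p : P ⟶ X) :
    ofRight s ≫ p = ofRight (s ≫ p.right) := by
  ext <;> simp [ofRight]

lemma ofRight_injective [HasInitial C] {T : C} {P : Arrow C} {s t : T ⟶ P.right}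
    (h : ofRight s = ofRight t) : s = t := congr_arg CommaMorphism.right h

lemma isPullback_left {P X Y Z : Arrow C} {p : P ⟶ X} {q : P ⟶ Y} {f : X ⟶ Z} {g : Y ⟶ Z}
    (h : IsPullback p q f g) : IsPullback p.left q.left f.left g.left := by
  refine IsPullback.mk' (by simpa using congr_arg CommaMorphism.left h.w) ?_ ?_
  · intro T s t h₁ h₂
    exact ofLeft_injective (h.hom_ext (by rw [ofLeft_comp, ofLeft_comp, h₁])
      (by rw [ofLeft_comp, ofLeft_comp, h₂]))
  · intro T s t hst
    obtain ⟨l, h₁, h₂⟩ := h.exists_lift (ofLeft s) (ofLeft t)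
      (by rw [ofLeft_comp, ofLeft_comp, hst])
    exact ⟨l.left, congr_arg CommaMorphism.left h₁, congr_arg CommaMorphism.left h₂⟩

lemma isPullback_right [HasInitial C] {P X Y Z : Arrow C} {p : P ⟶ X} {q : P ⟶ Y} {f : X ⟶ Z}
    {g : Y ⟶ Z} (h : IsPullback p q f g) : IsPullback p.right q.right f.right g.right := by
  refine IsPullback.mk' (by simpa using congr_arg CommaMorphism.right h.w) ?_ ?_
  · intro T s t h₁ h₂
    exact ofRight_injective (h.hom_ext (by rw [ofRight_comp, ofRight_comp, h₁])
      (by rw [ofRight_comp, ofRight_comp, h₂]))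
  · intro T s t hst
    obtain ⟨l, h₁, h₂⟩ := h.exists_lift (ofRight s) (ofRight t)
      (by rw [ofRight_comp, ofRight_comp, hst])
    exact ⟨l.right, congr_arg CommaMorphism.right h₁, congr_arg CommaMorphism.right h₂⟩

lemma isPullback_arrow {P X Y Z : Arrow C} {p : P ⟶ X} {q : P ⟶ Y} {f : X ⟶ Z} {g : Y ⟶ Z}
    (hl : IsPullback p.left q.left f.left g.left)
    (hr : IsPullback p.right q.right f.right g.right) : IsPullback p q f g := by
  refine IsPullback.mk' (by ext; exacts [hl.w, hr.w]) ?_ ?_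
  · intro T s t h₁ h₂
    ext
    · exact hl.hom_ext (congr_arg CommaMorphism.left h₁) (congr_arg CommaMorphism.left h₂)
    · exact hr.hom_ext (congr_arg CommaMorphism.right h₁) (congr_arg CommaMorphism.right h₂)
  · intro T s t hst
    obtain ⟨l, hl₁, hl₂⟩ := hl.exists_lift s.left t.left (congr_arg CommaMorphism.left hst)
    obtain ⟨r, hr₁, hr₂⟩ := hr.exists_lift s.right t.right (congr_arg CommaMorphism.right hst)
    have e : l ≫ P.hom = T.hom ≫ r := hr.hom_ext
      (by rw [Category.assoc, Category.assoc, ← Arrow.w p, hr₁, reassoc_of% hl₁, Arrow.w s])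
      (by rw [Category.assoc, Category.assoc, ← Arrow.w q, hr₂, reassoc_of% hl₂, Arrow.w t])
    exact ⟨Arrow.homMk l r e, by ext <;> simp [hl₁, hr₁], by ext <;> simp [hl₂, hr₂]⟩

lemma isZero_arrow {Z : Arrow C} (hl : IsZero Z.left) (hr : IsZero Z.right) : IsZero Z :=
  ⟨fun X => ⟨⟨⟨Arrow.homMk (hl.to_ _) (hr.to_ _) (hl.eq_of_src _ _)⟩, fun f => by
      ext; exacts [hl.eq_of_src _ _, hr.eq_of_src _ _]⟩⟩,
    fun X => ⟨⟨⟨Arrow.homMk (hl.from_ _) (hr.from_ _) (hr.eq_of_tgt _ _)⟩, fun f => by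
      ext; exacts [hl.eq_of_tgt _ _, hr.eq_of_tgt _ _]⟩⟩⟩

variable [HasZeroObject C]

open ZeroObject in
instance : HasZeroObject (Arrow C) :=
  ⟨Arrow.mk (𝟙 (0 : C)), isZero_arrow (isZero_zero C) (isZero_zero C)⟩

open ZeroObject in
lemma isZero_left_right {Z : Arrow C} (h : IsZero Z) : IsZero Z.left ∧ IsZero Z.right := by
  let e : Z ≅ Arrow.mk (𝟙 (0 : C)) :=
    h.iso (isZero_arrow (isZero_zero C) (isZero_zero C))
  exact ⟨(isZero_zero C).of_iso ((Arrow.leftFunc).mapIso e),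
    (isZero_zero C).of_iso ((Arrow.rightFunc).mapIso e)⟩

lemma isKernelOf_left_right {K X Y : Arrow C} {k : K ⟶ X} {f : X ⟶ Y} (h : IsKernelOf k f) :
    IsKernelOf k.left f.left ∧ IsKernelOf k.right f.right := by
  obtain ⟨Z, hZ, h⟩ := h
  have := HasZeroObject.hasInitial (C := C)
  obtain ⟨hl, hr⟩ := isZero_left_right hZ
  refine ⟨⟨_, hl, ?_⟩, ⟨_, hr, ?_⟩⟩
  · convert! isPullback_left h
    exacts [hl.eq_of_tgt _ _, hl.eq_of_src _ _]
  · convert! isPullback_right h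
    exacts [hr.eq_of_tgt _ _, hr.eq_of_src _ _]

end Arrow

/-! ### Double extensions -/

section Double

variable {C : Type u} [Category.{v} C] {D : ObjectProperty C} {W : MorphismProperty C}

lemma squareExt_comp [HasPullbacks C] (H : ExtClass D W) {b a c : Arrow C} {φ : b ⟶ a}
    {ψ : a ⟶ c} (hφ : squareExt W φ) (hψ : squareExt W ψ) : squareExt W (φ ≫ ψ) := by
  have hQ := IsPullback.of_hasPullback c.hom (φ.right ≫ ψ.right)
  have hφQ := IsPullback.of_hasPullback a.hom φ.right
  have hψQ := IsPullback.of_hasPullback c.hom ψ.right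
  obtain ⟨hφl, hφr, hb, ha, -⟩ := id hφ
  obtain ⟨hψl, hψr, -, hc, -⟩ := id hψ
  have h₁ : W (hφQ.lift φ.left b.hom φ.w) := squareExt_comparison H hφ hφQ (by simp) (by simp)
  have h₂ : W (hψQ.lift ψ.left a.hom ψ.w) := squareExt_comparison H hψ hψQ (by simp) (by simp)
  have hDQ : D (pullback c.hom (φ.right ≫ ψ.right)) :=
    H.source (H.of_isPullback hQ hc (H.source (H.comp hφr hψr)))
  -- the pullback of the comparison of `ψ`
  let m : pullback a.hom φ.right ⟶ pullback c.hom (φ.right ≫ ψ.right) :=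
    hQ.lift (pullback.fst _ _ ≫ ψ.left) (pullback.snd _ _)
      (by simp [pullback.condition_assoc])
  let n : pullback c.hom (φ.right ≫ ψ.right) ⟶ pullback c.hom ψ.right :=
    hψQ.lift (pullback.fst _ _) (pullback.snd _ _ ≫ φ.right)
      (by simp [pullback.condition])
  have hm : IsPullback (pullback.fst a.hom φ.right) m (hψQ.lift ψ.left a.hom ψ.w) n := by
    refine IsPullback.mk' (hψQ.hom_ext (by simp [m, n])
      (by simp [m, n, pullback.condition])) ?_ ?_
    · intro T s t e₁ e₂
      refine hφQ.hom_ext e₁ ?_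
      simpa [m] using congr_arg (· ≫ pullback.snd _ _) e₂
    · intro T s t e
      have e₁ := congr_arg (· ≫ pullback.fst _ _) e
      have e₂ := congr_arg (· ≫ pullback.snd _ _) e
      simp [n] at e₁ e₂
      exact ⟨hφQ.lift s (t ≫ pullback.snd _ _) (by simpa using e₂), by simp,
        hQ.hom_ext (by simp [m, e₁]) (by simp [m])⟩
  refine squareExt_mk H (H.comp hφl hψl) (H.comp hφr hψr) hb hQ
    (l := hφQ.lift φ.left b.hom φ.w ≫ m) (by simp [m]) (by simp [m])
    (H.comp h₁ (H.of_isPullback hm h₂ hDQ))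

lemma squareExt_cancel [HasPullbacks C] (H : ExtClass D W) {b a c : Arrow C} {φ : b ⟶ a}
    {ψ : a ⟶ c} (hφ : squareExt W φ) (hφψ : squareExt W (φ ≫ ψ)) : squareExt W ψ := by
  have hQ := IsPullback.of_hasPullback c.hom (φ.right ≫ ψ.right)
  have hψQ := IsPullback.of_hasPullback c.hom ψ.right
  obtain ⟨hφl, hφr, hb, ha, -⟩ := id hφ
  obtain ⟨hl, hr, -, hc, -⟩ := id hφψ
  have hψl : W ψ.left := H.cancel hφl hl
  have hψr : W ψ.right := H.cancel hφr hr
  have h₁ : W (hQ.lift (φ.left ≫ ψ.left) b.hom (by simp)) :=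
    squareExt_comparison H hφψ hQ (by simp) (by simp)
  let n : pullback c.hom (φ.right ≫ ψ.right) ⟶ pullback c.hom ψ.right :=
    hψQ.lift (pullback.fst _ _) (pullback.snd _ _ ≫ φ.right)
      (by simp [pullback.condition])
  have hn : IsPullback (pullback.snd _ _) n φ.right (pullback.snd c.hom ψ.right) :=
    (IsPullback.of_right (h₁₁ := n) (by simpa [n] using hQ) (by simp [n]) hψQ).flip
  refine squareExt_mk H hψl hψr ha hψQ (l := hψQ.lift ψ.left a.hom ψ.w) (by simp) (by simp)
    (H.cancel hφl ?_)
  have e : φ.left ≫ hψQ.lift ψ.left a.hom ψ.w = hQ.lift (φ.left ≫ ψ.left) b.hom (by simp) ≫ n :=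
    hψQ.hom_ext (by simp [n]) (by simp [n])
  rw [e]
  exact H.comp h₁ (H.of_isPullback hn hφr (H.source (H.of_isPullback hψQ hc (H.source hψr))))

lemma squareExt_of_isPullback [HasPullbacks C] [HasInitial C] (H : ExtClass D W)
    {d b c a : Arrow C} {x : d ⟶ b} {φ₀ : d ⟶ c} {φ : b ⟶ a} {ψ : c ⟶ a}
    (h : IsPullback x φ₀ φ ψ) (hφ : squareExt W φ) (hc : W c.hom) : squareExt W φ₀ := by
  have hl := isPullback_left h
  have hr := isPullback_right h
  obtain ⟨hφl, hφr, hb, ha, -⟩ := id hφ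
  have hφ₀l := H.of_isPullback hl hφl (H.source hc)
  have hφ₀r := H.of_isPullback hr hφr (H.target hc)
  have hQ := IsPullback.of_hasPullback c.hom φ₀.right
  have hQb := IsPullback.of_hasPullback a.hom φ.right
  have hq := H.of_isPullback hQ hc (H.source hφ₀r)
  let n : pullback c.hom φ₀.right ⟶ pullback a.hom φ.right :=
    hQb.lift (pullback.fst _ _ ≫ ψ.left) (pullback.snd _ _ ≫ x.right)
      (by simp [hr.w, pullback.condition_assoc])
  let l : d.left ⟶ pullback c.hom φ₀.right := hQ.lift φ₀.left d.hom φ₀.w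
  have hn : IsPullback x.left l (hQb.lift φ.left b.hom φ.w) n := by
    refine IsPullback.mk' (hQb.hom_ext (by simp [l, n, hl.w]) (by simp [l, n])) ?_ ?_
    · intro T s t e₁ e₂
      refine hl.hom_ext e₁ ?_
      simpa [l] using congr_arg (· ≫ pullback.fst _ _) e₂
    · intro T s t e
      have e₁ := congr_arg (· ≫ pullback.fst _ _) e
      have e₂ := congr_arg (· ≫ pullback.snd _ _) e
      simp [n] at e₁ e₂
      refine ⟨hl.lift s (t ≫ pullback.fst _ _) (by simpa using e₁), by simp,
        hQ.hom_ext (by simp [l]) (hr.hom_ext ?_ ?_)⟩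
      · simp [l, ← Arrow.w x, -Arrow.w, -Arrow.w_assoc, e₂]
      · simp [l, ← Arrow.w φ₀, -Arrow.w, -Arrow.w_assoc, ← pullback.condition]
  have hlW : W l := H.of_isPullback hn
    (squareExt_comparison H hφ hQb (by simp) (by simp)) (H.source hq)
  have hd : W d.hom := by
    rw [show d.hom = l ≫ pullback.snd _ _ by simp [l]]
    exact H.comp hlW hq
  exact squareExt_mk H hφ₀l hφ₀r hd hQ (l := l) (by simp [l]) (by simp [l]) hlW

lemma squareExt_split [HasPullbacks C] [HasInitial C] (H : ExtClass D W)
    {B₀ A₀ B A Q : Arrow C} {f₀ : B₀ ⟶ A₀} {f : B ⟶ A} {b : B₀ ⟶ B} {a : A₀ ⟶ A}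
    {s₀ : A₀ ⟶ B₀} {s : A ⟶ B} {p : Q ⟶ A₀} {q : Q ⟶ B} {l : B₀ ⟶ Q}
    (hf₀ : squareExt W f₀) (hb : squareExt W b) (ha : squareExt W a) (w : f₀ ≫ a = b ≫ f)
    (w' : s₀ ≫ b = a ≫ s) (hs₀ : s₀ ≫ f₀ = 𝟙 _) (hs : s ≫ f = 𝟙 _)
    (h : IsPullback p q a f) (h₁ : l ≫ p = f₀) (h₂ : l ≫ q = b) : squareExt W l := by
  have hL := isPullback_left h
  have hR := isPullback_right h
  have wL := congr_arg CommaMorphism.left w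
  have wR := congr_arg CommaMorphism.right w
  have wL' := congr_arg CommaMorphism.left w'
  have wR' := congr_arg CommaMorphism.right w'
  have sL := congr_arg CommaMorphism.left hs
  have sR := congr_arg CommaMorphism.right hs
  have s₀L := congr_arg CommaMorphism.left hs₀
  have s₀R := congr_arg CommaMorphism.right hs₀
  have l₁L := congr_arg CommaMorphism.left h₁
  have l₁R := congr_arg CommaMorphism.right h₁
  have l₂L := congr_arg CommaMorphism.left h₂
  have l₂R := congr_arg CommaMorphism.right h₂
  dsimp at wL wR wL' wR' sL sR s₀L s₀R l₁L l₁R l₂L l₂R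
  have hl : W l.left := H.split hf₀.1 hb.1 ha.1 wL wL' s₀L sL hL l₁L l₂L
  have hr : W l.right := H.split hf₀.2.1 hb.2.1 ha.2.1 wR wR' s₀R sR hR l₁R l₂R
  -- the comparisons of `b` and `a` are the vertical edges of a square of split epimorphisms
  have hPb := IsPullback.of_hasPullback B.hom b.right
  have hPa := IsPullback.of_hasPullback A.hom a.right
  have hPl := IsPullback.of_hasPullback Q.hom l.right
  have hb' : W (hPb.lift b.left B₀.hom b.w) := squareExt_comparison H hb hPb (by simp) (by simp)
  have ha' : W (hPa.lift a.left A₀.hom a.w) := squareExt_comparison H ha hPa (by simp) (by simp)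
  let n : pullback B.hom b.right ⟶ pullback A.hom a.right :=
    hPa.lift (pullback.fst _ _ ≫ f.left) (pullback.snd _ _ ≫ f₀.right)
      (by simp [wR, pullback.condition_assoc])
  let σ : pullback A.hom a.right ⟶ pullback B.hom b.right :=
    hPb.lift (pullback.fst _ _ ≫ s.left) (pullback.snd _ _ ≫ s₀.right)
      (by simp [wR', pullback.condition_assoc])
  let u : pullback Q.hom l.right ⟶ A₀.left := pullback.fst _ _ ≫ p.left
  let t : pullback Q.hom l.right ⟶ pullback B.hom b.right :=
    hPb.lift (pullback.fst _ _ ≫ q.left) (pullback.snd _ _)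
      (by simp [pullback.condition_assoc, l₂R])
  have ht : IsPullback u t (hPa.lift a.left A₀.hom a.w) n := by
    refine IsPullback.mk' (hPa.hom_ext (by simp [u, t, n, hL.w]) ?_) ?_ ?_
    · simp [u, t, n, pullback.condition_assoc, l₁R]
    · intro T x y e₁ e₂
      have e₃ := congr_arg (· ≫ pullback.fst _ _) e₂
      have e₄ := congr_arg (· ≫ pullback.snd _ _) e₂
      simp [t] at e₃ e₄
      exact hPl.hom_ext (hL.hom_ext (by simpa [u] using e₁) (by simpa using e₃)) e₄
    · intro T x y e
      have e₃ := congr_arg (· ≫ pullback.fst _ _) e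
      have e₄ := congr_arg (· ≫ pullback.snd _ _) e
      simp [n] at e₃ e₄
      refine ⟨hPl.lift (hL.lift x (y ≫ pullback.fst _ _) (by simpa using e₃))
        (y ≫ pullback.snd _ _) (hR.hom_ext ?_ ?_), by simp [u], hPb.hom_ext (by simp [t])
          (by simp [t])⟩
      · simp only [Category.assoc, ← Arrow.w p, hL.lift_fst_assoc, e₄, l₁R]
      · simp only [Category.assoc, ← Arrow.w q, hL.lift_snd_assoc, l₂R, pullback.condition]
  refine squareExt_mk H hl hr hf₀.2.2.1 hPl (l := hPl.lift l.left B₀.hom l.w) (by simp) (by simp)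
    (H.split hf₀.1 hb' ha' (b := hPb.lift b.left B₀.hom b.w) (s₀ := s₀.left) (s := σ)
      ?_ ?_ s₀L ?_ ht ?_ ?_)
  · exact hPa.hom_ext (by simp [n, wL]) (by simp [n])
  · exact hPb.hom_ext (by simp [σ, wL']) (by simp [σ])
  · exact hPa.hom_ext (by simp [σ, n, sL]) (by simp [σ, n, s₀R])
  · simp [u, l₁L]
  · exact hPb.hom_ext (by simp [t, l₂L]) (by simp [t])

lemma squareExt_exists_quotient [HasPullbacks C] [HasInitial C] (H : ExtClass D W)
    {S X : Arrow C} {p₁ p₂ : S ⟶ X} (d : X ⟶ S) (hd₁ : d ≫ p₁ = 𝟙 _) (hd₂ : d ≫ p₂ = 𝟙 _)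
    (hp : ∀ {T : Arrow C} (s t : T ⟶ S), s ≫ p₁ = t ≫ p₁ → s ≫ p₂ = t ≫ p₂ → s = t)
    (hp₁ : squareExt W p₁) :
    ∃ (Y : Arrow C) (q : X ⟶ Y), squareExt W q ∧ IsPullback p₁ p₂ q q := by
  obtain ⟨q₀, hq₀⟩ : ∃ Y₀, ∃ q₀ : X.left ⟶ Y₀, W q₀ ∧ IsPullback p₁.left p₂.left q₀ q₀ := by
    refine H.exists_quotient d.left (congr_arg CommaMorphism.left hd₁)
      (congr_arg CommaMorphism.left hd₂) (fun {T} s t h₁ h₂ => ?_) hp₁.1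
    exact ofLeft_injective (hp _ _ (by rw [ofLeft_comp, ofLeft_comp, h₁])
      (by rw [ofLeft_comp, ofLeft_comp, h₂]))
  obtain ⟨Y₁, q₁, hq₁⟩ : ∃ Y₁, ∃ q₁ : X.right ⟶ Y₁, W q₁ ∧
      IsPullback p₁.right p₂.right q₁ q₁ := by
    refine H.exists_quotient d.right (congr_arg CommaMorphism.right hd₁)
      (congr_arg CommaMorphism.right hd₂) (fun {T} s t h₁ h₂ => ?_) hp₁.2.1
    exact ofRight_injective (hp _ _ (by rw [ofRight_comp, ofRight_comp, h₁])
      (by rw [ofRight_comp, ofRight_comp, h₂]))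
  obtain ⟨q₀, hq₀, hS₀⟩ := hq₀
  obtain ⟨hq₁, hS₁⟩ := hq₁
  obtain ⟨y, hy⟩ := H.exists_desc (X.hom ≫ q₁) hq₀ (fun s t e => by
    obtain ⟨r, rfl, rfl⟩ := hS₀.exists_lift s t e
    simp [hS₁.w])
  have hX : W X.hom := hp₁.2.2.2.1
  have hyW : W y := H.cancel hq₀ (by rw [hy]; exact H.comp hX hq₁)
  refine ⟨Arrow.mk y, Arrow.homMk q₀ q₁ hy, ?_, isPullback_arrow hS₀ hS₁⟩
  have hQ := IsPullback.of_hasPullback y q₁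
  have hG := IsPullback.of_hasPullback q₀ (pullback.fst y q₁)
  have hp₁Q : IsPullback (pullback.fst q₀ (pullback.fst y q₁)) (hS₁.lift
      (pullback.fst q₀ (pullback.fst y q₁) ≫ X.hom)
      (pullback.snd q₀ (pullback.fst y q₁) ≫ pullback.snd y q₁)
      (by simp [← hy, pullback.condition_assoc, pullback.condition])) X.hom p₁.right := by
    refine IsPullback.mk' (by simp) ?_ ?_
    · intro T s t e₁ e₂
      have e₃ := congr_arg (· ≫ p₂.right) e₂
      simp at e₃
      refine hG.hom_ext e₁ (hQ.hom_ext ?_ (by simpa using e₃))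
      simp [← pullback.condition, reassoc_of% e₁]
    · intro T s t e
      exact ⟨hG.lift s (hQ.lift (s ≫ q₀) (t ≫ p₂.right) (by simp [hy, reassoc_of% e, hS₁.w]))
        (by simp), by simp, hS₁.hom_ext (by simp [e]) (by simp)⟩
  have hm := squareExt_comparison H hp₁ (a := X) hp₁Q
    (l := hG.lift p₁.left (hQ.lift (p₂.left ≫ q₀) (S.hom ≫ p₂.right)
      (by simp [hy])) (by simp [hS₀.w]))
    (by simp) (hS₁.hom_ext (by simp) (by simp))
  refine squareExt_mk H hq₀ hq₁ hX hQ (l := hQ.lift q₀ X.hom hy) (by simp) (by simp)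
    (H.of_kernelPair hq₀ hS₀ (H.source (H.of_isPullback hQ hyW (H.source hq₁))) hG hm ?_)
  exact hQ.hom_ext (by simp) (by simp)

/-- Double extensions, as morphisms between extensions, form a class of extensions. -/
lemma ExtClass.squareExt [HasPullbacks C] [HasZeroObject C] (H : ExtClass D W) :
    ExtClass (fun f : Arrow C => W f.hom) (squareExt W) := by
  have := HasZeroObject.hasInitial (C := C)
  refine
  { source := fun h => h.2.2.1
    target := fun h => h.2.2.2.1
    of_isIso := fun f hX hf => squareExt_of_isIso_right H
      (H.of_isIso _ (H.source hX) inferInstance) hX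
    comp := squareExt_comp H
    cancel := squareExt_cancel H
    of_isPullback := squareExt_of_isPullback H
    zero := fun hZ => H.of_isIso _ (H.zero (isZero_left_right hZ).1)
      (isIso_of_isInitial (isZero_left_right hZ).1.isInitial (isZero_left_right hZ).2.isInitial _)
    epi := fun {X Y f} hf => ⟨fun g h e => ?_⟩
    exists_desc := fun {X Y Z f} g hf hg => ?_
    split := squareExt_split H
    exists_quotient := squareExt_exists_quotient H
    isIso_of_kernel := fun {K X Y k f} hf hk hK => ?_ }
  · have := H.epi hf.1
    have := H.epi hf.2.1
    ext
    · rw [← cancel_epi f.left]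
      exact congr_arg CommaMorphism.left e
    · rw [← cancel_epi f.right]
      exact congr_arg CommaMorphism.right e
  · obtain ⟨l, hl⟩ := H.exists_desc g.left hf.1 (fun {T} s t e => by
      have := hg (ofLeft s) (ofLeft t) (by rw [ofLeft_comp, ofLeft_comp, e])
      rw [ofLeft_comp, ofLeft_comp] at this
      exact ofLeft_injective this)
    obtain ⟨r, hr⟩ := H.exists_desc g.right hf.2.1 (fun {T} s t e => by
      have := hg (ofRight s) (ofRight t) (by rw [ofRight_comp, ofRight_comp, e])
      rw [ofRight_comp, ofRight_comp] at this
      exact ofRight_injective this)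
    have := H.epi hf.1
    exact ⟨Arrow.homMk l r (by
      rw [← cancel_epi f.left, reassoc_of% hl, Arrow.w_assoc f, hr, Arrow.w g]), by
        ext <;> simp [hl, hr]⟩
  · have := H.isIso_of_kernel hf.1 (isKernelOf_left_right hk).1 (isZero_left_right hK).1
    have := H.isIso_of_kernel hf.2.1 (isKernelOf_left_right hk).2 (isZero_left_right hK).2
    exact Arrow.isIso_of_isIso_left_of_isIso_right f

end Double

/-! ### Reflections and strongly Birkhoff subcategories -/

section Reflection

variable {C : Type u} [Category.{v} C]

/-- `η : X ⟶ X'` is a reflection of `X` into the full subcategory of the objects in `D`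
which satisfy `P`, relative to the full subcategory `D`. -/
structure IsReflection (D P : ObjectProperty C) {X X' : C} (η : X ⟶ X') : Prop where
  mem : D X'
  prop : P X'
  existsUnique : ∀ {Z : C}, D Z → P Z → ∀ g : X ⟶ Z, ∃! h : X' ⟶ Z, η ≫ h = g

/-- A class of extensions `W` and a property `P` such that the objects with `P` form a strongly
Birkhoff subcategory: they are reflective among the objects in `D`, and the naturality squares
of the unit at extensions are double extensions. (At identities this says that the components of
the unit are extensions.) -/
def StronglyBirkhoff (D : ObjectProperty C) (W : MorphismProperty C) (P : ObjectProperty C) :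
    Prop :=
  ∀ ⦃X Y : C⦄ (f : X ⟶ Y), W f → ∃ (X' Y' : C) (ηX : X ⟶ X') (ηY : Y ⟶ Y') (f' : X' ⟶ Y')
    (w : ηX ≫ f' = f ≫ ηY), IsReflection D P ηX ∧ IsReflection D P ηY ∧
      squareExt W (Arrow.homMk ηX ηY w : Arrow.mk f ⟶ Arrow.mk f')

variable {D : ObjectProperty C} {W : MorphismProperty C} {P : ObjectProperty C}

namespace IsReflection

lemma exists_map {X X' Y Y' : C} {η : X ⟶ X'} {θ : Y ⟶ Y'} (hη : IsReflection D P η)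
    (hθ : IsReflection D P θ) (f : X ⟶ Y) : ∃ f' : X' ⟶ Y', η ≫ f' = f ≫ θ :=
  (hη.existsUnique hθ.mem hθ.prop (f ≫ θ)).exists

lemma hom_ext {X X' Y Y' : C} {η : X ⟶ X'} {θ : Y ⟶ Y'} (hη : IsReflection D P η)
    (hθ : IsReflection D P θ) {g h : X' ⟶ Y'} (e : η ≫ g = η ≫ h) : g = h :=
  (hη.existsUnique hθ.mem hθ.prop _).unique e rfl

lemma exists_iso {X X' X'' : C} {η : X ⟶ X'} {θ : X ⟶ X''} (hη : IsReflection D P η)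
    (hθ : IsReflection D P θ) : ∃ e : X' ≅ X'', η ≫ e.hom = θ := by
  obtain ⟨f, hf⟩ := hη.exists_map hθ (𝟙 X)
  obtain ⟨g, hg⟩ := hθ.exists_map hη (𝟙 X)
  simp only [Category.id_comp] at hf hg
  exact ⟨⟨f, g, hη.hom_ext hη (by simp [reassoc_of% hf, hg]),
    hθ.hom_ext hθ (by simp [reassoc_of% hg, hf])⟩, hf⟩

end IsReflection

namespace StronglyBirkhoff

lemma exists_reflection (HP : StronglyBirkhoff D W P) (H : ExtClass D W) {X : C} (hX : D X) :
    ∃ (X' : C) (η : X ⟶ X'), IsReflection D P η := by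
  obtain ⟨X', -, η, -, -, -, h, -, -⟩ := HP (𝟙 X) (H.of_isIso _ hX inferInstance)
  exact ⟨X', η, h⟩

variable [HasPullbacks C] [HasZeroObject C]

lemma squareExt_unit (HP : StronglyBirkhoff D W P) (H : ExtClass D W) {X Y X' Y' : C} {f : X ⟶ Y}
    (hf : W f) {ηX : X ⟶ X'} {ηY : Y ⟶ Y'} {f' : X' ⟶ Y'} (hX : IsReflection D P ηX)
    (hY : IsReflection D P ηY) (w : ηX ≫ f' = f ≫ ηY) :
    squareExt W (Arrow.homMk ηX ηY w : Arrow.mk f ⟶ Arrow.mk f') := by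
  obtain ⟨X'', Y'', θX, θY, f'', w', hX', hY', h⟩ := HP f hf
  obtain ⟨i, hi⟩ := hX'.exists_iso hX
  obtain ⟨j, hj⟩ := hY'.exists_iso hY
  have e : i.hom ≫ f' = f'' ≫ j.hom :=
    hX'.hom_ext hY (by rw [reassoc_of% hi, w, reassoc_of% w', hj])
  have : (Arrow.homMk ηX ηY w : Arrow.mk f ⟶ Arrow.mk f') =
      (Arrow.homMk θX θY w' : Arrow.mk f ⟶ Arrow.mk f'') ≫
        (Arrow.isoMk' f'' f' i j e).hom := by
    ext <;> simp [hi, hj]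
  rw [this]
  refine squareExt_comp H h (H.squareExt.of_isIso _ h.2.2.2.1 inferInstance)

/-- The comparison morphism of a naturality square of the unit. -/
lemma comparison (HP : StronglyBirkhoff D W P) (H : ExtClass D W) {X Y X' Y' : C} {f : X ⟶ Y}
    (hf : W f) {ηX : X ⟶ X'} {ηY : Y ⟶ Y'} {f' : X' ⟶ Y'} (hX : IsReflection D P ηX)
    (hY : IsReflection D P ηY) {Q : C} {p : Q ⟶ X'} {q : Q ⟶ Y} (hQ : IsPullback p q f' ηY)
    {l : X ⟶ Q} (h₁ : l ≫ p = ηX) (h₂ : l ≫ q = f) : W l := by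
  have w : ηX ≫ f' = f ≫ ηY := by rw [← h₁, ← h₂, Category.assoc, hQ.w, Category.assoc]
  exact squareExt_comparison H (HP.squareExt_unit H hf hX hY w) hQ h₁ h₂

lemma map (HP : StronglyBirkhoff D W P) (H : ExtClass D W) {X Y X' Y' : C} {f : X ⟶ Y}
    (hf : W f) {ηX : X ⟶ X'} {ηY : Y ⟶ Y'} {f' : X' ⟶ Y'} (hX : IsReflection D P ηX)
    (hY : IsReflection D P ηY) (w : ηX ≫ f' = f ≫ ηY) : W f' :=
  (HP.squareExt_unit H hf hX hY w).2.2.2.1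

end StronglyBirkhoff

end Reflection

/-! ### Trivial, normal and central extensions -/

section Trivial

variable {C : Type u} [Category.{v} C]

/-- Trivial extensions, in terms of reflections relative to `D`. -/
def TrivialExt (D : ObjectProperty C) (W : MorphismProperty C) (P : ObjectProperty C) {X Y : C}
    (f : X ⟶ Y) : Prop :=
  W f ∧ ∃ (X' Y' : C) (ηX : X ⟶ X') (ηY : Y ⟶ Y') (f' : X' ⟶ Y'),
    IsReflection D P ηX ∧ IsReflection D P ηY ∧ IsPullback ηX f f' ηY

/-- Normal extensions, in terms of reflections relative to `D`. -/
def NormalExt (D : ObjectProperty C) (W : MorphismProperty C) (P : ObjectProperty C) {X Y : C}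
    (f : X ⟶ Y) : Prop :=
  W f ∧ ∃ (R : C) (π₁ π₂ : R ⟶ X), IsPullback π₁ π₂ f f ∧ TrivialExt D W P π₁

/-- For `π : R ⟶ X`, the pullback `T = X ×_{IX} IR` of the reflection of `π` along the unit,
with the comparison morphism `t : R ⟶ T`. When `W` is strongly Birkhoff, `T ⟶ X` is the reflection
of `π` among the trivial extensions of `X`. -/
structure Trivialization (D P : ObjectProperty C) {R X : C} (π : R ⟶ X) where
  /-- the reflection of the domain -/
  IR : C
  /-- the reflection of the codomain -/
  IX : C
  /-- the pullback `X ×_{IX} IR` -/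
  T : C
  /-- the unit at the domain -/
  ηR : R ⟶ IR
  /-- the unit at the codomain -/
  ηX : X ⟶ IX
  /-- the reflection of `π` -/
  Iπ : IR ⟶ IX
  hR : IsReflection D P ηR
  hX : IsReflection D P ηX
  /-- the projection of the pullback to `IR` -/
  toI : T ⟶ IR
  /-- the projection of the pullback to `X` -/
  toX : T ⟶ X
  isPullback : IsPullback toI toX Iπ ηX
  /-- the comparison morphism -/
  t : R ⟶ T
  t_toI : t ≫ toI = ηR
  t_toX : t ≫ toX = π

variable {D : ObjectProperty C} {W : MorphismProperty C} {P : ObjectProperty C}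

lemma Trivialization.t_toI_assoc {R X Z : C} {π : R ⟶ X} (τ : Trivialization D P π)
    (h : τ.IR ⟶ Z) : τ.t ≫ τ.toI ≫ h = τ.ηR ≫ h := by
  rw [← Category.assoc, τ.t_toI]

lemma Trivialization.t_toX_assoc {R X Z : C} {π : R ⟶ X} (τ : Trivialization D P π)
    (h : X ⟶ Z) : τ.t ≫ τ.toX ≫ h = π ≫ h := by
  rw [← Category.assoc, τ.t_toX]

lemma Trivialization.w {R X : C} {π : R ⟶ X} (τ : Trivialization D P π) :
    τ.ηR ≫ τ.Iπ = π ≫ τ.ηX := by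
  rw [← τ.t_toI, Category.assoc, τ.isPullback.w, τ.t_toX_assoc]

namespace Trivialization

lemma isIso_t_iff {R X : C} {π : R ⟶ X} (hπ : W π)
    (τ : Trivialization D P π) : IsIso τ.t ↔ TrivialExt D W P π := by
  refine ⟨fun _ => ⟨hπ, _, _, _, _, τ.Iπ, τ.hR, τ.hX, τ.isPullback.of_iso (asIso τ.t).symm
    (Iso.refl _) (Iso.refl _) (Iso.refl _) (by simp [← τ.t_toI]) (by simp [← τ.t_toX])
    (by simp) (by simp)⟩, ?_⟩
  rintro ⟨-, X', Y', θR, θX, π', hR, hX, h⟩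
  obtain ⟨i, hi⟩ := hR.exists_iso τ.hR
  obtain ⟨j, hj⟩ := hX.exists_iso τ.hX
  have e : π' ≫ j.hom = i.hom ≫ τ.Iπ :=
    hR.hom_ext τ.hX (by rw [reassoc_of% h.w, hj, reassoc_of% hi, τ.w])
  have h' : IsPullback τ.ηR π τ.Iπ τ.ηX := h.of_iso (Iso.refl _) i (Iso.refl _) j
    (by simpa using hi) (by simp) e (by simpa using hj)
  have e' : τ.t = (h'.isoIsPullback _ _ τ.isPullback).hom :=
    τ.isPullback.hom_ext (by simp [τ.t_toI]) (by simp [τ.t_toX])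
  rw [e']
  infer_instance

/-- The functoriality of the reflection among trivial extensions. -/
lemma exists_map {R X R' X' : C} {π : R ⟶ X} {π' : R' ⟶ X'} (τ : Trivialization D P π)
    (τ' : Trivialization D P π') {ρ : R ⟶ R'} {ξ : X ⟶ X'} (w : ρ ≫ π' = π ≫ ξ) :
    ∃ (κ : τ.T ⟶ τ'.T) (Iρ : τ.IR ⟶ τ'.IR), τ.ηR ≫ Iρ = ρ ≫ τ'.ηR ∧
      κ ≫ τ'.toI = τ.toI ≫ Iρ ∧ κ ≫ τ'.toX = τ.toX ≫ ξ ∧ τ.t ≫ κ = ρ ≫ τ'.t := by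
  obtain ⟨Iρ, hIρ⟩ := τ.hR.exists_map τ'.hR ρ
  obtain ⟨Iξ, hIξ⟩ := τ.hX.exists_map τ'.hX ξ
  have e : Iρ ≫ τ'.Iπ = τ.Iπ ≫ Iξ := τ.hR.hom_ext τ'.hX (by
    rw [reassoc_of% hIρ, τ'.w, reassoc_of% w, reassoc_of% τ.w, hIξ])
  have e' : (τ.toI ≫ Iρ) ≫ τ'.Iπ = (τ.toX ≫ ξ) ≫ τ'.ηX := by
    rw [Category.assoc, e, reassoc_of% τ.isPullback.w, hIξ, Category.assoc]
  refine ⟨τ'.isPullback.lift _ _ e', Iρ, hIρ, by simp, by simp, τ'.isPullback.hom_ext ?_ ?_⟩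
  · simp [τ.t_toI_assoc, hIρ, τ'.t_toI]
  · simp [τ.t_toX_assoc, w, τ'.t_toX]

end Trivialization

variable [HasPullbacks C]

lemma nonempty_trivialization (H : ExtClass D W) (HP : StronglyBirkhoff D W P) {R X : C}
    {π : R ⟶ X} (hπ : W π) : Nonempty (Trivialization D P π) := by
  obtain ⟨IR, ηR, hR⟩ := HP.exists_reflection H (H.source hπ)
  obtain ⟨IX, ηX, hX⟩ := HP.exists_reflection H (H.target hπ)
  obtain ⟨Iπ, w⟩ := hR.exists_map hX π
  exact ⟨⟨IR, IX, pullback Iπ ηX, ηR, ηX, Iπ, hR, hX, pullback.fst _ _, pullback.snd _ _,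
    .of_hasPullback _ _, pullback.lift ηR π w, pullback.lift_fst _ _ _,
    pullback.lift_snd _ _ _⟩⟩

variable [HasZeroObject C]

namespace Trivialization

lemma ext_t (H : ExtClass D W) (HP : StronglyBirkhoff D W P) {R X : C} {π : R ⟶ X} (hπ : W π)
    (τ : Trivialization D P π) : W τ.t :=
  HP.comparison H hπ τ.hR τ.hX τ.isPullback τ.t_toI τ.t_toX

/-- Given split extensions `π` and `π'` and a morphism `(ρ, ξ)` between them, compatible with the
sections, whose components are extensions, the naturality square of the comparison morphism `t` is
a double extension: `l : R ⟶ T ×_{T'} R'` is an extension.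

Indeed, `l` is also the comparison morphism of the square of split epimorphisms which has `π` as
upper edge and the induced morphism `IR ×_{IR'} R' ⟶ IX ×_{IX'} X'` as lower edge. -/
lemma naturality (H : ExtClass D W) (HP : StronglyBirkhoff D W P) {R X R' X' : C} {π : R ⟶ X}
    {π' : R' ⟶ X'} {δ : X ⟶ R} {δ' : X' ⟶ R'} {ρ : R ⟶ R'} {ξ : X ⟶ X'} (hπ : W π)
    (hδ : δ ≫ π = 𝟙 X) (hδ' : δ' ≫ π' = 𝟙 X') (hρ : W ρ) (hξ : W ξ) (w : ρ ≫ π' = π ≫ ξ)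
    (w' : δ ≫ ρ = ξ ≫ δ') (τ : Trivialization D P π) (τ' : Trivialization D P π')
    {κ : τ.T ⟶ τ'.T} {Iρ : τ.IR ⟶ τ'.IR} (hIρ : τ.ηR ≫ Iρ = ρ ≫ τ'.ηR)
    (hκ₁ : κ ≫ τ'.toI = τ.toI ≫ Iρ) (hκ₂ : κ ≫ τ'.toX = τ.toX ≫ ξ)
    {M : C} {m₁ : M ⟶ τ.T} {m₂ : M ⟶ R'} (hM : IsPullback m₁ m₂ κ τ'.t) {l : R ⟶ M}
    (hl₁ : l ≫ m₁ = τ.t) (hl₂ : l ≫ m₂ = ρ) : W l := by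
  obtain ⟨Iξ, hIξ⟩ := τ.hX.exists_map τ'.hX ξ
  obtain ⟨Iδ, hIδ⟩ := τ.hX.exists_map τ.hR δ
  obtain ⟨Iδ', hIδ'⟩ := τ'.hX.exists_map τ'.hR δ'
  have e₁ : Iρ ≫ τ'.Iπ = τ.Iπ ≫ Iξ := τ.hR.hom_ext τ'.hX (by
    rw [reassoc_of% hIρ, τ'.w, reassoc_of% w, reassoc_of% τ.w, hIξ])
  have e₂ : Iδ ≫ Iρ = Iξ ≫ Iδ' := τ.hX.hom_ext τ'.hR (by
    rw [reassoc_of% hIδ, hIρ, reassoc_of% w', reassoc_of% hIξ, hIδ'])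
  have e₃ : Iδ ≫ τ.Iπ = 𝟙 _ := τ.hX.hom_ext τ.hX (by
    rw [reassoc_of% hIδ, τ.w, reassoc_of% hδ, Category.comp_id])
  have hNR := IsPullback.of_hasPullback Iρ τ'.ηR
  have hNX := IsPullback.of_hasPullback Iξ τ'.ηX
  let νR : R ⟶ pullback Iρ τ'.ηR := hNR.lift τ.ηR ρ hIρ
  let νX : X ⟶ pullback Iξ τ'.ηX := hNX.lift τ.ηX ξ hIξ
  -- the vertical edges are extensions because the subcategory is strongly Birkhoff
  have hνR : W νR := HP.comparison H hρ τ.hR τ'.hR hNR (by simp [νR]) (by simp [νR])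
  have hνX : W νX := HP.comparison H hξ τ.hX τ'.hX hNX (by simp [νX]) (by simp [νX])
  let n : pullback Iρ τ'.ηR ⟶ pullback Iξ τ'.ηX :=
    hNX.lift (pullback.fst _ _ ≫ τ.Iπ) (pullback.snd _ _ ≫ π') (by
      rw [Category.assoc, ← e₁, pullback.condition_assoc, τ'.w, Category.assoc])
  let s : pullback Iξ τ'.ηX ⟶ pullback Iρ τ'.ηR :=
    hNR.lift (pullback.fst _ _ ≫ Iδ) (pullback.snd _ _ ≫ δ') (by
      rw [Category.assoc, e₂, pullback.condition_assoc, hIδ', Category.assoc])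
  let v : M ⟶ pullback Iρ τ'.ηR := hNR.lift (m₁ ≫ τ.toI) m₂ (by
    rw [Category.assoc, ← hκ₁, reassoc_of% hM.w, τ'.t_toI])
  have hMv : IsPullback (m₁ ≫ τ.toX) v νX n := by
    refine IsPullback.mk' (hNX.hom_ext ?_ ?_) ?_ ?_
    · simp [νX, n, v, τ.isPullback.w]
    · simp [νX, n, v, ← hκ₂, reassoc_of% hM.w, τ'.t_toX]
    · intro A x y h₁ h₂
      have h₃ := congr_arg (· ≫ pullback.fst _ _) h₂
      have h₄ := congr_arg (· ≫ pullback.snd _ _) h₂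
      simp [v] at h₃ h₄
      exact hM.hom_ext (τ.isPullback.hom_ext (by simpa using h₃) (by simpa using h₁)) h₄
    · intro A x y h
      have h₃ := congr_arg (· ≫ pullback.fst _ _) h
      have h₄ := congr_arg (· ≫ pullback.snd _ _) h
      simp [νX, n] at h₃ h₄
      have hT := τ.isPullback.lift_fst (y ≫ pullback.fst _ _) x (by simpa using h₃.symm)
      have hT' := τ.isPullback.lift_snd (y ≫ pullback.fst _ _) x (by simpa using h₃.symm)
      refine ⟨hM.lift (τ.isPullback.lift (y ≫ pullback.fst _ _) x (by simpa using h₃.symm))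
        (y ≫ pullback.snd _ _) (τ'.isPullback.hom_ext ?_ ?_), by simp,
        hNR.hom_ext (by simp [v]) (by simp [v])⟩
      · simp [hκ₁, reassoc_of% hT, τ'.t_toI, pullback.condition]
      · simp [hκ₂, reassoc_of% hT', τ'.t_toX, h₄]
  refine H.split hπ hνR hνX (f := n) (s₀ := δ) (s := s) (hNX.hom_ext ?_ ?_) (hNR.hom_ext ?_ ?_)
    hδ (hNX.hom_ext ?_ ?_) hMv ?_ (hNR.hom_ext ?_ ?_)
  · simp [νX, νR, n, τ.w]
  · simp [νX, νR, n, w]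
  · simp [νX, νR, s, hIδ]
  · simp [νX, νR, s, w']
  · simp [s, n, e₃]
  · simp [s, n, hδ']
  · rw [reassoc_of% hl₁, τ.t_toX]
  · simp [νR, v, reassoc_of% hl₁, τ.t_toI]
  · simp [νR, v, hl₂]

end Trivialization

/-- Trivial extensions are stable under pullback. -/
lemma TrivialExt.of_isPullback (H : ExtClass D W) (HP : StronglyBirkhoff D W P)
    {X₀ X Y₀ Y : C} {x : X₀ ⟶ X} {f₀ : X₀ ⟶ Y₀} {f : X ⟶ Y} {y : Y₀ ⟶ Y}
    (h : IsPullback x f₀ f y) (hf : TrivialExt D W P f) (hY₀ : D Y₀) : TrivialExt D W P f₀ := by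
  have hf₀ := H.of_isPullback h hf.1 hY₀
  obtain ⟨-, X', Y', ηX, ηY, f', hX, hY, hf'⟩ := hf
  obtain ⟨τ⟩ := nonempty_trivialization H HP hf₀
  refine (τ.isIso_t_iff hf₀).1 ?_
  obtain ⟨Ix, hIx⟩ := τ.hR.exists_map hX x
  obtain ⟨Iy, hIy⟩ := τ.hX.exists_map hY y
  have e : Ix ≫ f' = τ.Iπ ≫ Iy := τ.hR.hom_ext hY (by
    rw [reassoc_of% hIx, hf'.w, reassoc_of% τ.w, hIy, reassoc_of% h.w])
  -- a retraction of `t`, which exists because the reflection of `f` is a pullback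
  obtain ⟨r, hr₁, hr₂⟩ := hf'.exists_lift (τ.toI ≫ Ix) (τ.toX ≫ y) (by
    rw [Category.assoc, e, reassoc_of% τ.isPullback.w, hIy, Category.assoc])
  refine H.isIso_of_split_mono (τ.ext_t H HP hf₀) (h.lift r τ.toX hr₂) (h.hom_ext
    (hf'.hom_ext ?_ ?_) ?_)
  · simp [hr₁, τ.t_toI_assoc, hIx]
  · simp [hr₂, τ.t_toX_assoc, h.w]
  · simp [τ.t_toX]

lemma NormalExt.trivialExt_fst (H : ExtClass D W) (HP : StronglyBirkhoff D W P) {R X Y : C}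
    {f : X ⟶ Y} (hf : NormalExt D W P f) {π₁ π₂ : R ⟶ X} (h : IsPullback π₁ π₂ f f) :
    TrivialExt D W P π₁ := by
  obtain ⟨hW, R', π₁', π₂', h', hπ⟩ := hf
  refine hπ.of_isPullback H HP (x := (h.isoIsPullback _ _ h').hom) (y := 𝟙 X)
    (IsPullback.of_horiz_isIso ⟨by simp⟩) (H.source hW)

/-- A normal extension which is a split epimorphism is trivial, being the pullback along the
section of a projection of its kernel pair. -/
lemma NormalExt.trivialExt_of_section (H : ExtClass D W) (HP : StronglyBirkhoff D W P) {X Y : C}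
    {f : X ⟶ Y} (hf : NormalExt D W P f) {s : Y ⟶ X} (hs : s ≫ f = 𝟙 Y) :
    TrivialExt D W P f := by
  have h := IsPullback.of_hasPullback f f
  have hp := hf.trivialExt_fst H HP h
  refine hp.of_isPullback H HP (y := s) (x := h.lift (f ≫ s) (𝟙 X) (by simp [hs]))
    (IsPullback.mk' (by simp) ?_ ?_) (H.target hf.1)
  · intro T u v e _
    simpa using congr_arg (· ≫ pullback.snd f f) e
  · intro T u v e
    have e' : (u ≫ pullback.snd f f) ≫ f = v := by
      rw [Category.assoc, ← pullback.condition, reassoc_of% e, hs, Category.comp_id]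
    exact ⟨u ≫ pullback.snd f f, h.hom_ext (by simp [reassoc_of% e', e]) (by simp), e'⟩

/-- If the pullback of an extension `f` along some extension is trivial, then `f` is normal. -/
lemma normalExt_of_isPullback (H : ExtClass D W) (HP : StronglyBirkhoff D W P)
    {X₀ X Y₀ Y : C} {x : X₀ ⟶ X} {f₀ : X₀ ⟶ Y₀} {f : X ⟶ Y} {y : Y₀ ⟶ Y} (hf : W f) (hy : W y)
    (h : IsPullback x f₀ f y) (hf₀ : TrivialExt D W P f₀) : NormalExt D W P f := by
  have hx : W x := H.of_isPullback h.flip hy (H.source hf)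
  have hR := IsPullback.of_hasPullback f f
  have hR₀ := IsPullback.of_hasPullback f₀ f₀
  let δ : X ⟶ pullback f f := hR.lift (𝟙 X) (𝟙 X) rfl
  let δ₀ : X₀ ⟶ pullback f₀ f₀ := hR₀.lift (𝟙 X₀) (𝟙 X₀) rfl
  let ρ : pullback f₀ f₀ ⟶ pullback f f :=
    hR.lift (pullback.fst _ _ ≫ x) (pullback.snd _ _ ≫ x)
      (by simp [h.w, pullback.condition_assoc])
  have hπ : W (pullback.fst f f) := H.of_isPullback hR.flip hf (H.source hf)
  have hπ₀ : TrivialExt D W P (pullback.fst f₀ f₀) :=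
    hf₀.of_isPullback H HP hR₀.flip (H.source hf₀.1)
  have hρ : IsPullback ρ (pullback.fst f₀ f₀) (pullback.fst f f) x := by
    refine IsPullback.mk' (by simp [ρ]) ?_ ?_
    · intro T s t h₁ h₂
      have h₃ := congr_arg (· ≫ pullback.snd f f) h₁
      simp [ρ] at h₃
      refine hR₀.hom_ext h₂ (h.hom_ext (by simpa using h₃) ?_)
      simp [← pullback.condition, reassoc_of% h₂]
    · intro T s t e
      have e' : (s ≫ pullback.snd f f) ≫ f = (t ≫ f₀) ≫ y := by
        simp [← pullback.condition, reassoc_of% e, h.w]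
      exact ⟨hR₀.lift t (h.lift _ _ e') (by simp), hR.hom_ext (by simp [ρ, e]) (by simp [ρ]),
        by simp⟩
  have hρW : W ρ := H.of_isPullback hρ.flip hx (H.source hπ)
  obtain ⟨τ⟩ := nonempty_trivialization H HP hπ
  obtain ⟨τ₀⟩ := nonempty_trivialization H HP hπ₀.1
  have := (τ₀.isIso_t_iff hπ₀.1).2 hπ₀
  have hρw : ρ ≫ pullback.fst f f = pullback.fst f₀ f₀ ≫ x := hρ.w
  obtain ⟨κ, Iρ, hIρ, hκ₁, hκ₂, hκ₃⟩ := τ₀.exists_map τ hρw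
  refine ⟨hf, _, _, _, hR, (τ.isIso_t_iff hπ).1 ?_⟩
  have hM := IsPullback.of_hasPullback κ τ.t
  let l : pullback f₀ f₀ ⟶ pullback κ τ.t := hM.lift τ₀.t ρ hκ₃
  have hl : W l := Trivialization.naturality H HP hπ₀.1 (δ := δ₀) (δ' := δ) (by simp [δ₀])
    (by simp [δ]) hρW hx hρw (hR.hom_ext (by simp [δ, δ₀, ρ]) (by simp [δ, δ₀, ρ])) τ₀ τ hIρ hκ₁
    hκ₂ hM (by simp [l]) (by simp [l])
  have hlinv : IsIso l := H.isIso_of_split_mono hl (pullback.fst _ _ ≫ inv τ₀.t) (by simp [l])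
  have ht : W τ.t := τ.ext_t H HP hπ
  -- `ρ` descends along `ρ ≫ τ.t`, and this provides an inverse of `τ.t`
  obtain ⟨r, hr⟩ := H.exists_desc (f := ρ ≫ τ.t) ρ (H.comp hρW ht) (fun {T} u v e => by
    have e' : u ≫ τ₀.t ≫ κ = (v ≫ ρ) ≫ τ.t := by simp [hκ₃, e]
    have h₁ : hM.lift (u ≫ τ₀.t) (v ≫ ρ) (by simpa using e') = u ≫ l := by
      have : inv l ≫ τ₀.t = pullback.fst _ _ := by simp [l]
      rw [← cancel_mono (inv l), ← cancel_mono τ₀.t]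
      simp [this]
    have h₂ := congr_arg (· ≫ pullback.snd _ _) h₁
    simpa [l] using h₂.symm)
  have := H.epi hρW
  have := H.epi ht
  have h₁ : τ.t ≫ r = 𝟙 _ := by rw [← cancel_epi ρ]; simpa using hr
  exact H.isIso_of_split_mono ht r h₁

end Trivial

/-! ### The centralization of an extension -/

section Centralization

variable {C : Type u} [Category.{v} C]

/-- The construction of the reflection `f'` of an extension `f : X ⟶ Y` among the normal
extensions. Let `R` be the kernel pair of `f` with diagonal `δ`, and `t : R ⟶ T` the comparison of
its first projection `π₁` with the trivialization of `π₁`. Then `S`, which consists of the pairs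
`(x, y)` in `R` such that `t (x, y) = t (x, x)`, is an effective equivalence relation on `X`, and
`f'` is induced by `f` on the quotient `q : X ⟶ X'`. -/
structure Centralization (D : ObjectProperty C) (W : MorphismProperty C) (P : ObjectProperty C)
    {X Y : C} (f : X ⟶ Y) where
  /-- the kernel pair of `f` -/
  R : C
  /-- the first projection of the kernel pair -/
  π₁ : R ⟶ X
  /-- the second projection of the kernel pair -/
  π₂ : R ⟶ X
  isKernelPair : IsPullback π₁ π₂ f f
  /-- the diagonal of the kernel pair -/
  δ : X ⟶ R
  δ_π₁ : δ ≫ π₁ = 𝟙 X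
  δ_π₂ : δ ≫ π₂ = 𝟙 X
  /-- the trivialization of the first projection -/
  τ : Trivialization D P π₁
  /-- the equivalence relation on `X` to be divided out -/
  S : C
  /-- the inclusion of `S` in the kernel pair -/
  σ : S ⟶ R
  /-- the first projection of `S` -/
  p : S ⟶ X
  isPullback : IsPullback σ p τ.t (δ ≫ τ.t)
  /-- the quotient of `X` by `S` -/
  X' : C
  /-- the quotient map -/
  q : X ⟶ X'
  ext_q : W q
  isKernelPair_q : IsPullback p (σ ≫ π₂) q q
  /-- the induced morphism on the quotient -/
  f' : X' ⟶ Y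
  fac : q ≫ f' = f

attribute [simp] Centralization.δ_π₁ Centralization.δ_π₂ Centralization.fac

variable {D : ObjectProperty C} {W : MorphismProperty C} {P : ObjectProperty C}

lemma p_eq_of_isPullback {R X S : C} {π₁ : R ⟶ X} {δ : X ⟶ R} (hδ : δ ≫ π₁ = 𝟙 X)
    {τ : Trivialization D P π₁} {σ : S ⟶ R} {p : S ⟶ X}
    (h : IsPullback σ p τ.t (δ ≫ τ.t)) : σ ≫ π₁ = p := by
  have := h.w =≫ τ.toX
  simpa [τ.t_toX, hδ] using this

namespace Centralization

variable {X Y : C} {f : X ⟶ Y} (c : Centralization D W P f)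

@[simp]
lemma δ_π₁_assoc {Z : C} (h : X ⟶ Z) : c.δ ≫ c.π₁ ≫ h = h := by
  rw [← Category.assoc, c.δ_π₁, Category.id_comp]

@[simp]
lemma δ_π₂_assoc {Z : C} (h : X ⟶ Z) : c.δ ≫ c.π₂ ≫ h = h := by
  rw [← Category.assoc, c.δ_π₂, Category.id_comp]

@[simp]
lemma fac_assoc {Z : C} (h : Y ⟶ Z) : c.q ≫ c.f' ≫ h = f ≫ h := by
  rw [← Category.assoc, c.fac]

lemma σ_π₁ : c.σ ≫ c.π₁ = c.p := p_eq_of_isPullback c.δ_π₁ c.isPullback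

lemma σ_π₁_assoc {Z : C} (h : X ⟶ Z) : c.σ ≫ c.π₁ ≫ h = c.p ≫ h := by
  rw [← Category.assoc, c.σ_π₁]

end Centralization

lemma nonempty_centralization [HasPullbacks C] [HasZeroObject C] (H : ExtClass D W)
    (HP : StronglyBirkhoff D W P) {X Y : C} {f : X ⟶ Y} (hf : W f) :
    Nonempty (Centralization D W P f) := by
  have hR := IsPullback.of_hasPullback f f
  have hπ₁ : W (pullback.fst f f) := H.of_isPullback hR.flip hf (H.source hf)
  let δ := hR.lift (𝟙 X) (𝟙 X) rfl
  have hδ₁ : δ ≫ pullback.fst f f = 𝟙 X := by simp [δ]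
  have hδ₂ : δ ≫ pullback.snd f f = 𝟙 X := by simp [δ]
  obtain ⟨τ⟩ := nonempty_trivialization H HP hπ₁
  have hS := IsPullback.of_hasPullback τ.t (δ ≫ τ.t)
  have hp := p_eq_of_isPullback hδ₁ hS
  have hpW : W (pullback.snd τ.t (δ ≫ τ.t)) := H.of_isPullback hS (τ.ext_t H HP hπ₁) (H.source hf)
  obtain ⟨X', q, hq, hS'⟩ := H.exists_quotient (p₁ := pullback.snd τ.t (δ ≫ τ.t))
    (p₂ := pullback.fst τ.t (δ ≫ τ.t) ≫ pullback.snd f f) (hS.lift δ (𝟙 X) (by simp)) (by simp)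
    (by simpa using hδ₂) (fun s t h₁ h₂ => hS.hom_ext (hR.hom_ext
      (by simpa [hp] using h₁) (by simpa using h₂)) h₁) hpW
  obtain ⟨f', hf'⟩ := H.exists_desc f hq (fun u v e => by
    obtain ⟨r, rfl, rfl⟩ := hS'.exists_lift u v e
    simp [← hp, pullback.condition])
  exact ⟨⟨_, _, _, hR, δ, hδ₁, hδ₂, τ, _, _, _, hS, X', q, hq, hS', f', hf'⟩⟩

/-- A double extension induces an extension between kernel pairs. -/
lemma ext_kernelPair_map [HasPullbacks C] (H : ExtClass D W) {X Y Z V R R' : C} {f : X ⟶ Y}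
    {g : Z ⟶ V} {φ₀ : X ⟶ Z} {φ₁ : Y ⟶ V} {w : φ₀ ≫ g = f ≫ φ₁}
    (hφ : squareExt W (Arrow.homMk φ₀ φ₁ w : Arrow.mk f ⟶ Arrow.mk g)) {π₁ π₂ : R ⟶ X}
    (hR : IsPullback π₁ π₂ f f) {π₁' π₂' : R' ⟶ Z} (hR' : IsPullback π₁' π₂' g g) {ρ : R ⟶ R'}
    (h₁ : ρ ≫ π₁' = π₁ ≫ φ₀) (h₂ : ρ ≫ π₂' = π₂ ≫ φ₀) : W ρ := by
  have hφ₀ : W φ₀ := hφ.1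
  have hg : W g := hφ.2.2.2.1
  have hf : W f := hφ.2.2.1
  have hQ := IsPullback.of_hasPullback g φ₁
  have hc : W (hQ.lift φ₀ f w) := squareExt_comparison H hφ hQ (by simp) (by simp)
  have hG := IsPullback.of_hasPullback π₁' φ₀
  have hGW : W (pullback.fst π₁' φ₀) :=
    H.of_isPullback hG.flip hφ₀ (H.source (H.of_isPullback hR'.flip hg (H.source hg)))
  let e : pullback π₁' φ₀ ⟶ pullback g φ₁ :=
    hQ.lift (pullback.fst _ _ ≫ π₂') (pullback.snd _ _ ≫ f)
      (by rw [Category.assoc, ← hR'.w, pullback.condition_assoc, w, Category.assoc])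
  have hk : IsPullback π₂ (hG.lift ρ π₁ h₁) (hQ.lift φ₀ f w) e := by
    refine IsPullback.mk' (hQ.hom_ext (by simp [e, h₂]) (by simp [e, hR.w])) ?_ ?_
    · intro T s t e₁ e₂
      exact hR.hom_ext (by simpa using congr_arg (· ≫ pullback.snd π₁' φ₀) e₂) e₁
    · intro T s t h
      have e₁ := congr_arg (· ≫ pullback.fst g φ₁) h
      have e₂ := congr_arg (· ≫ pullback.snd g φ₁) h
      simp [e] at e₁ e₂
      have e₃ : (t ≫ pullback.snd π₁' φ₀) ≫ f = s ≫ f := by simpa using e₂.symm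
      refine ⟨hR.lift _ s e₃, by simp, hG.hom_ext (hR'.hom_ext ?_ ?_) (by simp)⟩
      · simp [h₁, pullback.condition]
      · simp [h₂, e₁]
  have hkW : W (hG.lift ρ π₁ h₁) := H.of_isPullback hk hc (H.source hGW)
  rw [← hG.lift_fst ρ π₁ h₁]
  exact H.comp hkW hGW

namespace Centralization

section

variable {X Y : C} {f : X ⟶ Y} (c : Centralization D W P f)

lemma ext_f' (H : ExtClass D W) (hf : W f) : W c.f' := H.cancel c.ext_q (by rwa [c.fac])

lemma ext_π₁ (H : ExtClass D W) (hf : W f) : W c.π₁ :=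
  H.of_isPullback c.isKernelPair.flip hf (H.source hf)

/-- The morphism from an extension to its centralization is a double extension. -/
lemma squareExt_q (H : ExtClass D W) (hf : W f) :
    squareExt W (Arrow.homMk c.q (𝟙 Y) (by simp) : Arrow.mk f ⟶ Arrow.mk c.f') := by
  have : IsIso (Arrow.homMk c.q (𝟙 Y) (by simp) : Arrow.mk f ⟶ Arrow.mk c.f').right :=
    inferInstanceAs (IsIso (𝟙 Y))
  exact squareExt_of_isIso_right H c.ext_q hf

/-- If `h` is a normal extension, all morphisms from `f` to `h` factor through the centralization
of `f`: the equivalence relation constructed from `h` is discrete. -/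
lemma exists_desc [HasPullbacks C] [HasZeroObject C] (H : ExtClass D W)
    (HP : StronglyBirkhoff D W P) {Z V : C} {h : Z ⟶ V} (hh : NormalExt D W P h) {g₀ : X ⟶ Z}
    {g₁ : Y ⟶ V} (w : g₀ ≫ h = f ≫ g₁) : ∃ r : c.X' ⟶ Z, c.q ≫ r = g₀ := by
  obtain ⟨d⟩ := nonempty_centralization H HP hh.1
  have : IsIso d.τ.t := (d.τ.isIso_t_iff (d.ext_π₁ H hh.1)).2 (hh.trivialExt_fst H HP d.isKernelPair)
  let ρ : c.R ⟶ d.R := d.isKernelPair.lift (c.π₁ ≫ g₀) (c.π₂ ≫ g₀)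
    (by simp [w, reassoc_of% c.isKernelPair.w])
  have hρ₁ : ρ ≫ d.π₁ = c.π₁ ≫ g₀ := by simp [ρ]
  have hρ₂ : ρ ≫ d.π₂ = c.π₂ ≫ g₀ := by simp [ρ]
  obtain ⟨κ, -, -, -, -, hκ⟩ := c.τ.exists_map d.τ hρ₁
  have e : c.σ ≫ ρ = c.p ≫ c.δ ≫ ρ := by
    rw [← cancel_mono d.τ.t]
    simp only [Category.assoc, ← hκ]
    rw [reassoc_of% c.isPullback.w]
  refine H.exists_desc g₀ c.ext_q (fun u v huv => ?_)
  obtain ⟨r, rfl, rfl⟩ := c.isKernelPair_q.exists_lift u v huv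
  have := e =≫ d.π₂
  simp only [Category.assoc, hρ₂, δ_π₂_assoc] at this
  simp [this]

/-- The centralization is a normal extension. Let `K` be the kernel of the comparison morphism
`R' ⟶ T'` for the kernel pair `R'` of `f'`. By naturality, `K` is covered by a part of `R` that is
sent to zero by `R ⟶ T`; this part is contained in `S`, hence it is sent to zero in `R'`. -/
lemma normalExt [HasPullbacks C] [HasZeroObject C] (H : ExtClass D W)
    (HP : StronglyBirkhoff D W P) (hf : W f) : NormalExt D W P c.f' := by
  have hf' := c.ext_f' H hf
  have hR := IsPullback.of_hasPullback c.f' c.f'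
  have hπ : W (pullback.fst c.f' c.f') := H.of_isPullback hR.flip hf' (H.source hf')
  obtain ⟨τ⟩ := nonempty_trivialization H HP hπ
  refine ⟨hf', _, _, _, hR, (τ.isIso_t_iff hπ).1 ?_⟩
  have hρw : (c.π₁ ≫ c.q) ≫ c.f' = (c.π₂ ≫ c.q) ≫ c.f' := by simp [c.isKernelPair.w]
  obtain ⟨ρ, hρ₁, hρ₂⟩ := hR.exists_lift _ _ hρw
  have hρ : W ρ := ext_kernelPair_map H (c.squareExt_q H hf) c.isKernelPair hR hρ₁ hρ₂
  let δ := hR.lift (𝟙 _) (𝟙 _) rfl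
  obtain ⟨κ, Iρ, hIρ, hκ₁, hκ₂, hκ₃⟩ := c.τ.exists_map τ hρ₁
  have hM := IsPullback.of_hasPullback κ τ.t
  have ht : W τ.t := τ.ext_t H HP hπ
  have hl : W (hM.lift c.τ.t ρ hκ₃) := Trivialization.naturality H HP (c.ext_π₁ H hf) (δ' := δ)
    c.δ_π₁ (by simp [δ]) hρ c.ext_q hρ₁ (hR.hom_ext (by simp [δ, hρ₁]) (by simp [δ, hρ₂])) c.τ τ
    hIρ hκ₁ hκ₂ hM (by simp) (by simp)
  let := HasZeroObject.zeroMorphismsOfZeroObject (C := C)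
  open ZeroObject in
  have hK := IsPullback.of_hasPullback τ.t (0 : (0 : C) ⟶ τ.T)
  have hKD := H.source (H.of_isPullback hK ht (H.zero (isZero_zero C)))
  refine H.isIso_of_kernel ht ⟨_, isZero_zero C, by
    convert! hK using 1
    · exact (isZero_zero C).eq_of_tgt _ _
    · exact (isZero_zero C).eq_of_src _ _⟩ ?_
  set k := pullback.fst τ.t (0 : (0 : C) ⟶ τ.T)
  have hk : k ≫ τ.t = 0 := by simp [k, pullback.condition]
  let m := hM.lift 0 k (by simp [hk])
  have hV := IsPullback.of_hasPullback (hM.lift c.τ.t ρ hκ₃) m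
  set v := pullback.fst (hM.lift c.τ.t ρ hκ₃) m
  set ε := pullback.snd (hM.lift c.τ.t ρ hκ₃) m
  have hε : Epi ε := H.epi (H.of_isPullback hV hl hKD)
  have hv₁ : v ≫ c.τ.t = 0 := by simpa [m] using hV.w =≫ pullback.fst _ _
  have hv₂ : v ≫ ρ = ε ≫ k := by simpa [m] using hV.w =≫ pullback.snd _ _
  have hv₃ : v ≫ c.π₁ = 0 := by
    have := hv₁ =≫ c.τ.toX
    rwa [Category.assoc, c.τ.t_toX, zero_comp] at this
  obtain ⟨s, hs, -⟩ := c.isPullback.exists_lift v 0 (by simp [hv₁])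
  have hv₄ : (v ≫ c.π₂) ≫ c.q = 0 := by
    have := c.isKernelPair_q.w
    rw [← c.σ_π₁] at this
    have := s ≫= this
    simp only [Category.assoc, reassoc_of% hs, reassoc_of% hv₃, zero_comp] at this
    simpa using this.symm
  have hv₅ : v ≫ ρ = 0 := hR.hom_ext (by simp [hρ₁, reassoc_of% hv₃])
    (by simpa [hρ₂] using hv₄)
  have hk₀ : k = 0 := by rw [← cancel_epi ε, ← hv₂, hv₅, comp_zero]
  rw [IsZero.iff_id_eq_zero]
  exact hK.hom_ext (by simpa using hk₀)
    ((isZero_zero C).eq_of_tgt _ _)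

end

/-- For a double extension `(φ₀, φ₁)` from `f` to `g`, the quotient maps of the centralizations
of `f` and `g` form a double extension. It is enough to compare the equivalence relations `S`, and
the comparison morphism between these is a pullback of the one for the trivializations. -/
lemma comparison [HasPullbacks C] [HasZeroObject C] (H : ExtClass D W)
    (HP : StronglyBirkhoff D W P) {X Y Z V : C} {f : X ⟶ Y} {g : Z ⟶ V}
    (c : Centralization D W P f) (d : Centralization D W P g) {φ₀ : X ⟶ Z} {φ₁ : Y ⟶ V}
    {w : φ₀ ≫ g = f ≫ φ₁} (hφ : squareExt W (Arrow.homMk φ₀ φ₁ w : Arrow.mk f ⟶ Arrow.mk g))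
    {ψ : c.X' ⟶ d.X'} (hψ : c.q ≫ ψ = φ₀ ≫ d.q) {Q : C} {p : Q ⟶ c.X'} {q : Q ⟶ Z}
    (hQ : IsPullback p q ψ d.q) {l : X ⟶ Q} (h₁ : l ≫ p = c.q) (h₂ : l ≫ q = φ₀) : W l := by
  have hφ₀ : W φ₀ := hφ.1
  have hg : W g := hφ.2.2.2.1
  have hf : W f := hφ.2.2.1
  have hψW : W ψ := H.cancel c.ext_q (by rw [hψ]; exact H.comp hφ₀ d.ext_q)
  have hQD : D Q := H.source (H.of_isPullback hQ.flip d.ext_q (H.source hψW))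
  have hρw : (c.π₁ ≫ φ₀) ≫ g = (c.π₂ ≫ φ₀) ≫ g := by
    simp [w, reassoc_of% c.isKernelPair.w]
  obtain ⟨ρ, hρ₁, hρ₂⟩ := d.isKernelPair.exists_lift _ _ hρw
  have hρ : W ρ := ext_kernelPair_map H hφ c.isKernelPair d.isKernelPair hρ₁ hρ₂
  have hδρ : c.δ ≫ ρ = φ₀ ≫ d.δ :=
    d.isKernelPair.hom_ext (by simp [hρ₁]) (by simp [hρ₂])
  obtain ⟨κ, Iρ, hIρ, hκ₁, hκ₂, hκ₃⟩ := c.τ.exists_map d.τ hρ₁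
  have hM := IsPullback.of_hasPullback κ d.τ.t
  have hl : W (hM.lift c.τ.t ρ hκ₃) := Trivialization.naturality H HP (c.ext_π₁ H hf)
    c.δ_π₁ d.δ_π₁ hρ hφ₀ hρ₁ hδρ c.τ d.τ hIρ hκ₁ hκ₂ hM (by simp) (by simp)
  have hG := IsPullback.of_hasPullback c.q p
  have hGD := H.source (H.of_isPullback hG c.ext_q hQD)
  obtain ⟨s, hs₁, hs₂⟩ := d.isKernelPair_q.exists_lift (pullback.fst c.q p ≫ φ₀)
    (pullback.snd c.q p ≫ q) (by
      rw [Category.assoc, ← hψ, pullback.condition_assoc, hQ.w, Category.assoc])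
  obtain ⟨γ, hγ₁, hγ₂⟩ := hM.exists_lift (pullback.fst c.q p ≫ c.δ ≫ c.τ.t) (s ≫ d.σ) (by
    rw [Category.assoc, Category.assoc, Category.assoc, hκ₃, d.isPullback.w, reassoc_of% hs₁,
      reassoc_of% hδρ])
  let m : c.S ⟶ pullback c.q p := hG.lift c.p ((c.σ ≫ c.π₂) ≫ l)
    (by rw [Category.assoc, h₁, c.isKernelPair_q.w])
  have hm₁ : m ≫ pullback.fst _ _ = c.p := by simp [m]
  have hm₂ : m ≫ pullback.snd _ _ = (c.σ ≫ c.π₂) ≫ l := by simp [m]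
  have hm : IsPullback c.σ m (hM.lift c.τ.t ρ hκ₃) γ := by
    refine IsPullback.mk' (hM.hom_ext ?_ (d.isKernelPair.hom_ext ?_ ?_)) ?_ ?_
    · simp [hγ₁, reassoc_of% hm₁, c.isPullback.w]
    · simp [hγ₂, hρ₁, d.σ_π₁, hs₁, reassoc_of% hm₁, c.σ_π₁_assoc]
    · simp [hγ₂, hρ₂, hs₂, reassoc_of% hm₂, h₂]
    · intro T x y e _
      exact c.isPullback.hom_ext e (by rw [← c.σ_π₁, reassoc_of% e])
    · intro T x y h
      have e₁ := h =≫ pullback.fst _ _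
      have e₂ := h =≫ pullback.snd _ _
      simp only [Category.assoc, IsPullback.lift_fst, IsPullback.lift_snd, hγ₁, hγ₂] at e₁ e₂
      obtain ⟨z, hz₁, hz₂⟩ := c.isPullback.exists_lift x (y ≫ pullback.fst _ _) (by simpa using e₁)
      refine ⟨z, hz₁, hG.hom_ext (by rw [Category.assoc, hm₁, hz₂]) (hQ.hom_ext ?_ ?_)⟩
      · have := z ≫= c.isKernelPair_q.w
        simp only [Category.assoc, reassoc_of% hz₁, reassoc_of% hz₂] at this
        simp only [Category.assoc, reassoc_of% hm₂, h₁, reassoc_of% hz₁, ← this,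
          pullback.condition]
      · simp only [Category.assoc, reassoc_of% hm₂, h₂, reassoc_of% hz₁, ← hρ₂, reassoc_of% e₂,
          hs₂]
  exact H.of_kernelPair c.ext_q c.isKernelPair_q hQD hG (H.of_isPullback hm hl hGD) hm₂

end Centralization

variable [HasPullbacks C] [HasZeroObject C]

/-- The quotient map is the unit of the reflection of extensions among normal extensions. -/
lemma Centralization.isReflection (H : ExtClass D W) (HP : StronglyBirkhoff D W P) {X Y : C}
    {f : X ⟶ Y} (hf : W f) (c : Centralization D W P f) :
    IsReflection (fun f : Arrow C => W f.hom) (fun f => NormalExt D W P f.hom)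
      (Arrow.homMk c.q (𝟙 Y) (by simp) : Arrow.mk f ⟶ Arrow.mk c.f') where
  mem := c.ext_f' H hf
  prop := c.normalExt H HP hf
  existsUnique := by
    intro h hh hN g
    have := H.epi c.ext_q
    obtain ⟨r, hr⟩ := c.exists_desc H HP hN (Arrow.w g)
    refine ⟨Arrow.homMk r g.right ?_, ?_, ?_⟩
    · rw [← cancel_epi c.q, reassoc_of% hr]
      simp
    · ext <;> simp [hr]
    · rintro g' rfl
      ext
      · rw [← cancel_epi c.q]
        simpa using hr.symm
      · simp

/-- The normal extensions form a strongly Birkhoff subcategory of the category of extensions. -/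
lemma StronglyBirkhoff.normalExt (H : ExtClass D W) (HP : StronglyBirkhoff D W P) :
    StronglyBirkhoff (fun f : Arrow C => W f.hom) (squareExt W)
      (fun f => NormalExt D W P f.hom) := by
  intro f g φ hφ
  obtain ⟨hφl, hφr, hf, hg, -⟩ := id hφ
  obtain ⟨c⟩ := nonempty_centralization H HP hf
  obtain ⟨d⟩ := nonempty_centralization H HP hg
  have hc := c.isReflection H HP hf
  have hd := d.isReflection H HP hg
  obtain ⟨ψ, hψ⟩ := hc.exists_map hd φ
  have hcW := c.squareExt_q H hf
  have hdW := d.squareExt_q H hg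
  have hψW : squareExt W ψ := squareExt_cancel H hcW (by
    rw [hψ]; exact squareExt_comp H hφ hdW)
  refine ⟨_, _, _, _, ψ, hψ, hc, hd, ?_⟩
  have := HasZeroObject.hasInitial (C := C)
  let θ : g ⟶ Arrow.mk d.f' := (Arrow.homMk d.q (𝟙 _) (by simp) : Arrow.mk g.hom ⟶ Arrow.mk d.f')
  have hQ := IsPullback.of_hasPullback ψ θ
  obtain ⟨l, hl₁, hl₂⟩ := hQ.exists_lift _ _ hψ
  refine squareExt_mk H.squareExt hcW hdW hφ hQ hl₁ hl₂ ?_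
  have hlW : W l.left := c.comparison H HP d hφ (congr_arg CommaMorphism.left hψ)
    (isPullback_left hQ) (congr_arg CommaMorphism.left hl₁) (congr_arg CommaMorphism.left hl₂)
  have : IsIso (pullback.fst ψ θ).right :=
    (isPullback_right hQ).isIso_fst_of_isIso (inferInstanceAs (IsIso (𝟙 g.right)))
  have : IsIso l.right := by
    have e : l.right ≫ (pullback.fst ψ θ).right = 𝟙 _ := congr_arg CommaMorphism.right hl₁
    have : IsIso (l.right ≫ (pullback.fst ψ θ).right) := by rw [e]; infer_instance
    exact IsIso.of_isIso_comp_right _ (pullback.fst ψ θ).right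
  exact squareExt_of_isIso_right H hlW hf

end Centralization

/-! ### Semi-abelian categories: the Mal'tsev property -/

section Base

variable {C : Type u} [Category.{v} C]

/-- The components of the unit of a reflective subcategory are reflections. -/
lemma isReflection_unit {P : ObjectProperty C} {L : C ⥤ P.FullSubcategory} (adj : L ⊣ P.ι)
    (X : C) : IsReflection (fun _ => True) P (adj.unit.app X) := by
  refine ⟨trivial, (L.obj X).property, fun {Z} _ hZ g => ?_⟩
  refine ⟨((adj.homEquiv X ⟨Z, hZ⟩).symm g).hom, ?_, fun h hh => ?_⟩
  · exact ((adj.homEquiv_unit X ⟨Z, hZ⟩ _).symm.trans (Equiv.apply_symm_apply _ _))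
  · have : (ObjectProperty.homMk h : L.obj X ⟶ ⟨Z, hZ⟩) = (adj.homEquiv X ⟨Z, hZ⟩).symm g := by
      rw [Equiv.eq_symm_apply, adj.homEquiv_unit]
      exact hh
    rw [← this]
    rfl

lemma IsBirkhoff.exists_isReflection {B : ObjectProperty C} (hB : IsBirkhoff B) (X : C) :
    ∃ (X' : C) (η : X ⟶ X'), IsReflection (fun _ => True) B η :=
  have := hB.isRightAdjoint
  ⟨_, _, isReflection_unit (Adjunction.ofIsRightAdjoint B.ι) X⟩

instance [SemiAbelian C] : Regular C := SemiAbelian.regular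

instance [SemiAbelian C] : HasZeroObject C := SemiAbelian.hasZeroObject

lemma exists_desc_of_isRegularEpi {X Y Z : C} {f : X ⟶ Y} (g : X ⟶ Z) (hf : IsRegularEpi f)
    (h : ∀ {T : C} (s t : T ⟶ X), s ≫ f = t ≫ f → s ≫ g = t ≫ g) : ∃ k : Y ⟶ Z, f ≫ k = g :=
  ⟨IsRegularEpi.desc f g (h _ _ (IsRegularEpi.w f)), IsRegularEpi.fac _ _ _⟩

section Regular

variable [Regular C]

lemma isRegularEpi_of_strongEpi {X Y : C} (f : X ⟶ Y) [StrongEpi f] : IsRegularEpi f :=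
  inferInstance

lemma isRegularEpi_comp {X Y Z : C} {f : X ⟶ Y} {g : Y ⟶ Z} (hf : IsRegularEpi f)
    (hg : IsRegularEpi g) : IsRegularEpi (f ≫ g) :=
  have := strongEpi_comp f g
  isRegularEpi_of_strongEpi _

lemma isRegularEpi_cancel {X Y Z : C} {f : X ⟶ Y} {g : Y ⟶ Z} (h : IsRegularEpi (f ≫ g)) :
    IsRegularEpi g :=
  have := strongEpi_of_strongEpi f g
  isRegularEpi_of_strongEpi _

lemma isRegularEpi_of_isPullback {P X Y Z : C} {x : P ⟶ X} {f₀ : P ⟶ Y} {f : X ⟶ Z} {y : Y ⟶ Z}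
    (h : IsPullback x f₀ f y) (hf : IsRegularEpi f) : IsRegularEpi f₀ :=
  Regular.regularEpiIsStableUnderBaseChange.of_isPullback h hf

lemma exists_regularEpi_mono_fac {X Y : C} (f : X ⟶ Y) :
    ∃ (I : C) (e : X ⟶ I) (m : I ⟶ Y), IsRegularEpi e ∧ Mono m ∧ e ≫ m = f :=
  ⟨_, (Regular.strongEpiMonoFactorisation f).e, (Regular.strongEpiMonoFactorisation f).m,
    inferInstance, inferInstance, by simp⟩

end Regular

variable [SemiAbelian C]

/-- Protomodularity: a subobject of `P` containing the image of a section of a split epimorphism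
`p : P ⟶ E` and the kernel of `p` is all of `P`. -/
lemma isIso_of_mono_of_split {P' P E K : C} {p : P ⟶ E} {s : E ⟶ P} (hs : s ≫ p = 𝟙 E)
    {m : P' ⟶ P} [Mono m] {s' : E ⟶ P'} (hs' : s' ≫ m = s) {k : K ⟶ P} (hk : IsKernelOf k p)
    {k' : K ⟶ P'} (hk' : k' ≫ m = k) : IsIso m := by
  have : IsSplitEpi p := ⟨⟨s, hs⟩⟩
  have : IsSplitEpi (m ≫ p) := ⟨⟨s', by rw [reassoc_of% hs', hs]⟩⟩
  have hk₂ : IsKernelOf k' (m ≫ p) := by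
    obtain ⟨Z, hZ, h⟩ := hk
    refine ⟨Z, hZ, IsPullback.mk' (by rw [reassoc_of% hk', h.w]) ?_ ?_⟩
    · intro T a b e _
      exact h.hom_ext (by rw [← hk', reassoc_of% e]) (hZ.eq_of_tgt _ _)
    · intro T a b e
      obtain ⟨l, hl, -⟩ := h.exists_lift (a ≫ m) b (by simpa using e)
      exact ⟨l, by rw [← cancel_mono m, Category.assoc, hk', hl], hZ.eq_of_tgt _ _⟩
  exact SemiAbelian.shortFive k' (m ≫ p) k p (𝟙 K) m (𝟙 E) inferInstance inferInstance hk₂ hk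
    (by simpa using hk') (by simp) inferInstance inferInstance

/-- Every relation in a semi-abelian category is difunctional. -/
lemma difunctional {S X Y : C} {r₁ : S ⟶ X} {r₂ : S ⟶ Y}
    (hr : ∀ {T : C} (s t : T ⟶ S), s ≫ r₁ = t ≫ r₁ → s ≫ r₂ = t ≫ r₂ → s = t)
    {T : C} {u v w : T ⟶ S} (huv : u ≫ r₂ = v ≫ r₂) (hvw : v ≫ r₁ = w ≫ r₁) :
    ∃ t : T ⟶ S, t ≫ r₁ = u ≫ r₁ ∧ t ≫ r₂ = w ≫ r₂ := by
  have hE := IsPullback.of_hasPullback r₂ r₂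
  have hF := IsPullback.of_hasPullback r₁ r₁
  have hV := IsPullback.of_hasPullback (pullback.snd r₂ r₂) (pullback.fst r₁ r₁)
  -- `V` classifies the triples `(u, v, w)`, and `V'` those for which the conclusion holds
  let V := pullback (pullback.snd r₂ r₂) (pullback.fst r₁ r₁)
  let a : V ⟶ X := pullback.fst _ _ ≫ pullback.fst _ _ ≫ r₁
  let b : V ⟶ Y := pullback.snd _ _ ≫ pullback.snd _ _ ≫ r₂
  have : Mono (prod.lift r₁ r₂) := ⟨fun s t e => hr s t
    (by simpa only [Category.assoc, prod.lift_fst] using e =≫ prod.fst)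
    (by simpa only [Category.assoc, prod.lift_snd] using e =≫ prod.snd)⟩
  have hV' := IsPullback.of_hasPullback (prod.lift a b) (prod.lift r₁ r₂)
  let σ : pullback r₁ r₁ ⟶ V :=
    hV.lift (hE.lift (pullback.fst _ _) (pullback.fst _ _) rfl) (𝟙 _) (by simp)
  let σ' := hV'.lift σ (pullback.snd r₁ r₁)
    (by ext <;> simp [σ, a, b, pullback.condition])
  obtain ⟨Z, hZ⟩ := HasZeroObject.zero (C := C)
  have hK := IsPullback.of_hasPullback (pullback.snd (pullback.snd r₂ r₂) (pullback.fst r₁ r₁))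
    (hZ.to_ (pullback r₁ r₁))
  set k := pullback.fst (pullback.snd (pullback.snd r₂ r₂) (pullback.fst r₁ r₁))
    (hZ.to_ (pullback r₁ r₁))
  have hk : IsKernelOf k (pullback.snd (pullback.snd r₂ r₂) (pullback.fst r₁ r₁)) :=
    ⟨Z, hZ, by convert! hK using 1; exact hZ.eq_of_tgt _ _⟩
  have e : (k ≫ pullback.snd _ _) ≫ pullback.snd r₁ r₁ =
      (k ≫ pullback.snd _ _) ≫ pullback.fst r₁ r₁ := by
    rw [hK.w, Category.assoc, Category.assoc]
    congr 1
    exact hZ.eq_of_src _ _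
  let k' := hV'.lift k (k ≫ pullback.fst _ _ ≫ pullback.fst _ _) (by
    simp only [Category.assoc] at e
    ext
    · simp only [Category.assoc, prod.lift_fst, a]
    · simp only [Category.assoc, prod.lift_snd, b, reassoc_of% e, ← pullback.condition_assoc,
        pullback.condition])
  have hm : IsIso (pullback.fst (prod.lift a b) (prod.lift r₁ r₂)) :=
    isIso_of_mono_of_split (s := σ) (by simp [σ]) (s' := σ') (by simp [σ']) hk (k' := k')
      (by simp [k'])
  let t : T ⟶ V := hV.lift (hE.lift u v huv) (hF.lift v w hvw) (by simp)
  have h₁ : pullback.snd (prod.lift a b) (prod.lift r₁ r₂) ≫ r₁ = pullback.fst _ _ ≫ a := by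
    simpa only [Category.assoc, prod.lift_fst] using (hV'.w =≫ prod.fst).symm
  have h₂ : pullback.snd (prod.lift a b) (prod.lift r₁ r₂) ≫ r₂ = pullback.fst _ _ ≫ b := by
    simpa only [Category.assoc, prod.lift_snd] using (hV'.w =≫ prod.snd).symm
  refine ⟨t ≫ inv (pullback.fst (prod.lift a b) (prod.lift r₁ r₂)) ≫ pullback.snd _ _, ?_, ?_⟩
  · simp [h₁, t, a]
  · simp [h₂, t, b]

/-- Let `l : X ⟶ Q` be a morphism to a relation `Q` between `A` and `B`. If `Q` is covered by
pairs `(a u, b w)` such that the pairs `(a u, b u)`, `(a v, b v)` and `(a w, b w)` satisfy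
`b u = b v` and `a v = a w`, then `l` is a regular epimorphism, because its image is difunctional.-/
lemma isRegularEpi_of_difunctional {X Q A B P : C} {l : X ⟶ Q} {a : Q ⟶ A} {b : Q ⟶ B}
    (hQ : ∀ {T : C} (s t : T ⟶ Q), s ≫ a = t ≫ a → s ≫ b = t ≫ b → s = t) {c : P ⟶ Q}
    (hc : IsRegularEpi c) {u v w : P ⟶ X} (huv : u ≫ l ≫ b = v ≫ l ≫ b)
    (hvw : v ≫ l ≫ a = w ≫ l ≫ a) (ha : c ≫ a = u ≫ l ≫ a) (hb : c ≫ b = w ≫ l ≫ b) :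
    IsRegularEpi l := by
  obtain ⟨I, e, m, he, hm, rfl⟩ := exists_regularEpi_mono_fac l
  simp only [Category.assoc] at huv hvw ha hb
  obtain ⟨t, ht₁, ht₂⟩ := difunctional (r₁ := m ≫ a) (r₂ := m ≫ b)
    (fun s t h₁ h₂ => by rw [← cancel_mono m]; exact hQ _ _ (by simpa using h₁) (by simpa using h₂))
    (u := u ≫ e) (v := v ≫ e) (w := w ≫ e) (by simpa using huv) (by simpa using hvw)
  have : t ≫ m = c := hQ _ _ (by simp [ht₁, ha]) (by simp [ht₂, hb])
  exact isRegularEpi_comp he (isRegularEpi_cancel (f := t) (by rwa [this]))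

/-- Reflexive relations are equivalence relations, hence kernel pairs of regular epimorphisms. -/
lemma exists_quotient_of_reflexive {S X : C} {p₁ p₂ : S ⟶ X} (d : X ⟶ S) (hd₁ : d ≫ p₁ = 𝟙 _)
    (hd₂ : d ≫ p₂ = 𝟙 _)
    (hp : ∀ {T : C} (s t : T ⟶ S), s ≫ p₁ = t ≫ p₁ → s ≫ p₂ = t ≫ p₂ → s = t) :
    ∃ (Y : C) (q : X ⟶ Y), IsRegularEpi q ∧ IsPullback p₁ p₂ q q := by
  obtain ⟨s, hs₁, hs₂⟩ := difunctional hp (u := p₂ ≫ d) (v := 𝟙 S) (w := p₁ ≫ d)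
    (by simp [hd₂]) (by simp [hd₁])
  obtain ⟨t, ht₁, ht₂⟩ := difunctional hp (u := pullback.fst p₂ p₁)
    (v := (pullback.fst p₂ p₁ ≫ p₂) ≫ d) (w := pullback.snd p₂ p₁)
    (by simp [hd₂]) (by simp [hd₁, pullback.condition])
  have hE : IsEquivalenceRelation p₁ p₂ := ⟨⟨
    { right_cancellation := fun _ f g h₁ h₂ => hp f g h₁ h₂
      r := d
      reflexivity₁ := hd₁
      reflexivity₂ := hd₂
      s := s
      symmetry₁ := by simpa [hd₁] using hs₁
      symmetry₂ := by simpa [hd₂] using hs₂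
      c := _
      isLimit := pullback.isLimit p₂ p₁
      t := t
      transitivity₁ := ht₁
      transitivity₂ := ht₂ }⟩⟩
  obtain ⟨Y, f, hf⟩ := SemiAbelian.exists_isKernelPair p₁ p₂ hE
  obtain ⟨I, e, m, he, hm, rfl⟩ := exists_regularEpi_mono_fac f
  refine ⟨I, e, he, IsPullback.mk' ?_ (fun _ _ _ h₁ h₂ => hp _ _ h₁ h₂) fun T a b h => ?_⟩
  · rw [← cancel_mono m]
    simpa using hf.w
  · exact hf.exists_lift a b (by rw [reassoc_of% h])

variable (C) in
/-- In a semi-abelian category, the regular epimorphisms form a class of extensions. -/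
lemma extClass_regularEpi : ExtClass (fun _ : C => True) (MorphismProperty.regularEpi C) where
  source _ := trivial
  target _ := trivial
  of_isIso f _ _ := inferInstanceAs (IsRegularEpi f)
  comp := isRegularEpi_comp
  cancel _ h := isRegularEpi_cancel h
  of_isPullback h hf _ := isRegularEpi_of_isPullback h hf
  zero _ := trivial
  epi {_ _ f} hf := have : IsRegularEpi f := hf; inferInstance
  exists_desc g hf h := exists_desc_of_isRegularEpi g hf h
  split {B₀ A₀ B A Q f₀ f b a s₀ s p q l} hf₀ hb ha w w' hs₀ hs h h₁ h₂ := by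
    have hP := IsPullback.of_hasPullback (f₀ ≫ a) a
    let c : pullback (f₀ ≫ a) a ⟶ Q := h.lift (pullback.snd _ _) (pullback.fst _ _ ≫ b)
      (by simp [← pullback.condition, w])
    have hc : IsPullback (pullback.fst _ _) c b q := by
      refine IsPullback.mk' (by simp [c]) ?_ ?_
      · intro T x y e₁ e₂
        exact hP.hom_ext e₁ (by simpa [c] using e₂ =≫ p)
      · intro T x y e
        have e' : x ≫ f₀ ≫ a = (y ≫ p) ≫ a := by rw [w, reassoc_of% e, Category.assoc, h.w]
        exact ⟨hP.lift x (y ≫ p) e', by simp, h.hom_ext (by simp [c]) (by simp [c, e])⟩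
    refine isRegularEpi_of_difunctional (a := q) (b := p) (c := c)
      (u := pullback.fst (f₀ ≫ a) a) (v := pullback.fst (f₀ ≫ a) a ≫ f₀ ≫ s₀)
      (w := pullback.snd (f₀ ≫ a) a ≫ s₀)
      (fun x y e₁ e₂ => h.hom_ext e₂ e₁) (isRegularEpi_of_isPullback hc hb) ?_ ?_ ?_ ?_
    · simp [h₁, hs₀]
    · have := pullback.condition (f := f₀ ≫ a) (g := a)
      simp [h₂, w', reassoc_of% this]
    · simp [c, h₂]
    · simp [c, h₁, hs₀]
  exists_quotient d hd₁ hd₂ hp _ := exists_quotient_of_reflexive d hd₁ hd₂ hp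
  isIso_of_kernel {K X Y k f} hf hk hK := by
    refine SemiAbelian.shortFive k f (k ≫ f) (𝟙 Y) (𝟙 K) f (𝟙 Y) hf inferInstance hk ?_ (by simp)
      rfl inferInstance inferInstance
    obtain ⟨Z, hZ, h⟩ := hk
    have : IsIso (hZ.from_ K) := isIso_of_isInitial hK.isInitial hZ.isInitial _
    exact ⟨Z, hZ, IsPullback.of_vert_isIso ⟨by simp [h.w]⟩⟩

lemma IsBirkhoff.isRegularEpi_unit {B : ObjectProperty C} (hB : IsBirkhoff B) {X X' : C}
    {η : X ⟶ X'} (hη : IsReflection (fun _ => True) B η) : IsRegularEpi η := by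
  obtain ⟨I, e, m, he, hm, rfl⟩ := exists_regularEpi_mono_fac η
  obtain ⟨k, hk, -⟩ := hη.existsUnique trivial (hB.of_mono m hm hη.prop) e
  have : k ≫ m = 𝟙 _ := hη.hom_ext hη (by simp [reassoc_of% hk])
  have : IsSplitEpi m := ⟨⟨k, this⟩⟩
  exact isRegularEpi_comp he inferInstance

/-- A Birkhoff subcategory of a semi-abelian category is strongly Birkhoff. With `ηX ≫ f' = f ≫ ηY`
the naturality square of the unit, the image `N` of the kernel pair of `f` in `X' × X'` is an
effective equivalence relation, and the quotient of `X'` by `N` belongs to the Birkhoff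
subcategory; so this quotient is `Y'`, that is, `N` is the kernel pair of `f'`. Now
difunctionality shows that the square is a double extension. -/
lemma IsBirkhoff.stronglyBirkhoff {B : ObjectProperty C} (hB : IsBirkhoff B) :
    StronglyBirkhoff (fun _ => True) (MorphismProperty.regularEpi C) B := by
  intro X Y f hf
  have H := extClass_regularEpi C
  obtain ⟨X', ηX, hX⟩ := hB.exists_isReflection X
  obtain ⟨Y', ηY, hY⟩ := hB.exists_isReflection Y
  obtain ⟨f', w⟩ := hX.exists_map hY f
  have hηX := hB.isRegularEpi_unit hX
  have hηY := hB.isRegularEpi_unit hY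
  refine ⟨X', Y', ηX, ηY, f', w, hX, hY, ?_⟩
  have hR := IsPullback.of_hasPullback f f
  let δ := hR.lift (𝟙 X) (𝟙 X) rfl
  obtain ⟨N, e, m, he, hm, hem⟩ := exists_regularEpi_mono_fac
    (prod.lift (pullback.fst f f ≫ ηX) (pullback.snd f f ≫ ηX))
  have he₁ : e ≫ m ≫ prod.fst = pullback.fst f f ≫ ηX := by rw [reassoc_of% hem, prod.lift_fst]
  have he₂ : e ≫ m ≫ prod.snd = pullback.snd f f ≫ ηX := by rw [reassoc_of% hem, prod.lift_snd]
  have hN : ∀ {T : C} (s t : T ⟶ N), s ≫ m ≫ prod.fst = t ≫ m ≫ prod.fst →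
      s ≫ m ≫ prod.snd = t ≫ m ≫ prod.snd → s = t := fun s t h₁ h₂ => by
    rw [← cancel_mono m]
    ext
    · simpa using h₁
    · simpa using h₂
  have hδ₁ : δ ≫ pullback.fst f f = 𝟙 X := by simp [δ]
  have hδ₂ : δ ≫ pullback.snd f f = 𝟙 X := by simp [δ]
  obtain ⟨d, hd⟩ := exists_desc_of_isRegularEpi (δ ≫ e) hηX (fun s t h => hN _ _
    (by simp [he₁, reassoc_of% hδ₁, h]) (by simp [he₂, reassoc_of% hδ₂, h]))
  obtain ⟨V, q, hq, hNq⟩ := exists_quotient_of_reflexive d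
    (by rw [← cancel_epi ηX, reassoc_of% hd, he₁, reassoc_of% hδ₁, Category.comp_id])
    (by rw [← cancel_epi ηX, reassoc_of% hd, he₂, reassoc_of% hδ₂, Category.comp_id]) hN
  have hV : B V := hB.of_regularEpi q hq hX.prop
  obtain ⟨k, hk⟩ := exists_desc_of_isRegularEpi (ηX ≫ q) hf (fun s t h => by
    obtain ⟨r, rfl, rfl⟩ := hR.exists_lift s t h
    have := e ≫= hNq.w
    simp only [Category.assoc] at he₁ he₂ this
    rw [reassoc_of% he₁, reassoc_of% he₂] at this
    simp [this])
  obtain ⟨k', hk', -⟩ := hY.existsUnique trivial hV k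
  have hfq : f' ≫ k' = q := (hX.existsUnique trivial hV (ηX ≫ q)).unique
    (by rw [reassoc_of% w, hk', hk]) rfl
  have hQ := IsPullback.of_hasPullback f' ηY
  have hQ₁ := IsPullback.of_hasPullback f (pullback.snd f' ηY)
  obtain ⟨n, hn₁, hn₂⟩ := hNq.exists_lift (pullback.fst f (pullback.snd f' ηY) ≫ ηX)
    (pullback.snd f (pullback.snd f' ηY) ≫ pullback.fst f' ηY) (by
      simp only [← hfq, Category.assoc, reassoc_of% w, pullback.condition_assoc])
  have hP := IsPullback.of_hasPullback e n
  refine squareExt_mk H hηX hηY hf hQ (l := hQ.lift ηX f w) (by simp) (by simp) ?_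
  refine isRegularEpi_of_difunctional (a := pullback.fst f' ηY) (b := pullback.snd f' ηY)
    (c := pullback.snd e n ≫ pullback.snd _ _) (u := pullback.fst e n ≫ pullback.snd f f)
    (v := pullback.fst e n ≫ pullback.fst f f) (w := pullback.snd e n ≫ pullback.fst _ _)
    (fun s t h₁ h₂ => hQ.hom_ext h₁ h₂)
    (isRegularEpi_comp (isRegularEpi_of_isPullback hP he) (isRegularEpi_of_isPullback hQ₁ hf))
    ?_ ?_ ?_ ?_
  · simp [pullback.condition]
  · simp [← he₁, pullback.condition_assoc, hn₁]
  · simp [← he₂, pullback.condition_assoc, hn₂]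
  · simp [pullback.condition]

end Base

/-! ### Galois structures in terms of reflections -/

section Galois

variable {C : Type u} [Category.{v} C]

/-- A full subcategory into which every object has a reflection is reflective. -/
lemma nonempty_reflective {P : ObjectProperty C}
    (h : ∀ X : C, ∃ (X' : C) (η : X ⟶ X'), IsReflection (fun _ => True) P η) :
    Nonempty (Reflective P.ι) := by
  choose X' η hη using h
  let e (X : C) (Y : P.FullSubcategory) :
      ((⟨X' X, (hη X).prop⟩ : P.FullSubcategory) ⟶ Y) ≃ (X ⟶ P.ι.obj Y) :=
    Equiv.ofBijective (fun g => η X ≫ g.hom)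
      ⟨fun g h e => by
        ext
        exact ((hη X).existsUnique trivial Y.property _).unique e rfl,
      fun g => by
        obtain ⟨h, hh, -⟩ := (hη X).existsUnique trivial Y.property g
        exact ⟨ObjectProperty.homMk h, hh⟩⟩
  have he (X : C) (Y Y' : P.FullSubcategory) (g : Y ⟶ Y') (h : _ ⟶ Y) :
      e X Y' (h ≫ g) = e X Y h ≫ P.ι.map g :=
    (Category.assoc (η X) h.hom g.hom).symm
  exact ⟨{ L := Adjunction.leftAdjointOfEquiv e he
           adj := Adjunction.adjunctionOfEquivLeft e he }⟩

lemma isTrivialExt_iff {P : ObjectProperty C} {E : MorphismProperty C}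
    (h : Nonempty (Reflective P.ι)) {X Y : C} {f : X ⟶ Y} :
    IsTrivialExt P E f ↔ TrivialExt (fun _ => True) E P f := by
  refine ⟨fun ⟨hf, _, hp⟩ => ⟨hf, _, _, _, _, _, isReflection_unit (reflectorAdjunction P.ι) X,
    isReflection_unit (reflectorAdjunction P.ι) Y, hp⟩, fun hf => ?_⟩
  obtain ⟨hR⟩ := h
  refine ⟨hf.1, hR, ?_⟩
  obtain ⟨-, X', Y', ηX, ηY, f', hX, hY, hp⟩ := hf
  have hX' := isReflection_unit (reflectorAdjunction P.ι) X
  have hY' := isReflection_unit (reflectorAdjunction P.ι) Y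
  obtain ⟨i, hi⟩ := hX.exists_iso hX'
  obtain ⟨j, hj⟩ := hY.exists_iso hY'
  have w := (reflectorAdjunction P.ι).unit.naturality f
  refine hp.of_iso (Iso.refl _) i (Iso.refl _) j (by simpa using hi) (by simp)
    (hX.hom_ext hY' ?_) (by simpa using hj)
  rw [reassoc_of% hp.w, hj, reassoc_of% hi]
  exact w

section FullSubcategory

variable {D : ObjectProperty C}

lemma isReflection_hom_iff {P : ObjectProperty C} {X X' : D.FullSubcategory} {η : X ⟶ X'} :
    IsReflection (fun _ => True) (P.inverseImage D.ι) η ↔ IsReflection D P η.hom := by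
  refine ⟨fun h => ⟨X'.property, h.prop, fun {Z} hZ hPZ g => ?_⟩,
    fun h => ⟨trivial, h.prop, fun {Z} _ hPZ g => ?_⟩⟩
  · obtain ⟨k, hk, hu⟩ := h.existsUnique (Z := ⟨Z, hZ⟩) trivial hPZ (ObjectProperty.homMk g)
    refine ⟨k.hom, congr_arg (·.hom) hk, fun k' hk' => ?_⟩
    rw [← hu (ObjectProperty.homMk k') (by ext; exact hk')]
    rfl
  · obtain ⟨k, hk, hu⟩ := h.existsUnique Z.property hPZ g.hom
    refine ⟨ObjectProperty.homMk k, by ext; exact hk, fun k' hk' => ?_⟩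
    ext
    exact hu _ (congr_arg (·.hom) hk')

lemma isPullback_of_hom {P X Y Z : D.FullSubcategory} {p : P ⟶ X} {q : P ⟶ Y} {f : X ⟶ Z}
    {g : Y ⟶ Z} (h : IsPullback p.hom q.hom f.hom g.hom) : IsPullback p q f g := by
  refine IsPullback.mk' (by ext; exact h.w) (fun T s t h₁ h₂ => ?_) (fun T s t e => ?_)
  · ext
    exact h.hom_ext (congr_arg (·.hom) h₁) (congr_arg (·.hom) h₂)
  · obtain ⟨l, hl₁, hl₂⟩ := h.exists_lift s.hom t.hom (congr_arg (·.hom) e)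
    exact ⟨ObjectProperty.homMk l, by ext; exact hl₁, by ext; exact hl₂⟩

/-- A pullback square in a full subcategory is a pullback square in the ambient category, if the
pullback in the ambient category lies in the subcategory. -/
lemma isPullback_hom [HasPullbacks C] {P X Y Z : D.FullSubcategory} {p : P ⟶ X} {q : P ⟶ Y}
    {f : X ⟶ Z} {g : Y ⟶ Z} (h : IsPullback p q f g) (hD : D (pullback f.hom g.hom)) :
    IsPullback p.hom q.hom f.hom g.hom := by
  have h' : IsPullback (P := (⟨pullback f.hom g.hom, hD⟩ : D.FullSubcategory))
    (ObjectProperty.homMk (pullback.fst f.hom g.hom))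
    (ObjectProperty.homMk (pullback.snd f.hom g.hom)) f g :=
    isPullback_of_hom (IsPullback.of_hasPullback f.hom g.hom)
  exact (IsPullback.of_hasPullback f.hom g.hom).of_iso (D.ι.mapIso (h'.isoIsPullback _ _ h))
    (Iso.refl _) (Iso.refl _) (Iso.refl _)
    (by simp [← ObjectProperty.FullSubcategory.comp_hom])
    (by simp [← ObjectProperty.FullSubcategory.comp_hom]) (by simp) (by simp)

end FullSubcategory

end Galois

namespace Level

variable {L : Level.{w, v}}

/-- The invariant of the tower: the extensions and the higher central extensions at the stage `L`
form a class of extensions with a strongly Birkhoff subcategory. -/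
structure IsAdmissible (L : Level.{w, v}) : Prop where
  hasPullbacks : HasPullbacks L.Arr
  hasZeroObject : HasZeroObject L.Arr
  extClass : ExtClass L.isExt L.isSuccExt
  stronglyBirkhoff : StronglyBirkhoff L.isExt L.isSuccExt L.isCExt

namespace IsAdmissible

lemma nonempty_reflective (hL : L.IsAdmissible) : Nonempty (Reflective L.cExt.ι) := by
  refine HigherCentral.nonempty_reflective fun X => ?_
  obtain ⟨X', η, hη⟩ := hL.stronglyBirkhoff.exists_reflection hL.extClass X.property
  exact ⟨⟨X', hη.mem⟩, ObjectProperty.homMk η, isReflection_hom_iff.2 hη⟩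

lemma isTrivial_iff (hL : L.IsAdmissible) {X Y : L.Ext} {f : X ⟶ Y} :
    L.IsTrivial f ↔ TrivialExt L.isExt L.isSuccExt L.isCExt f.hom := by
  have := hL.hasPullbacks
  have := hL.hasZeroObject
  have H := hL.extClass
  refine (isTrivialExt_iff hL.nonempty_reflective).trans ⟨?_, ?_⟩
  · rintro ⟨hf, X', Y', ηX, ηY, f', hX, hY, hp⟩
    have hX' := isReflection_hom_iff.1 hX
    have hY' := isReflection_hom_iff.1 hY
    have hf' := hL.stronglyBirkhoff.map H hf hX' hY' (congr_arg (·.hom) hp.w)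
    exact ⟨hf, _, _, _, _, _, hX', hY', isPullback_hom hp
      (H.source (H.of_isPullback (IsPullback.of_hasPullback _ _) hf' Y.property))⟩
  · rintro ⟨hf, X', Y', ηX, ηY, f', hX, hY, hp⟩
    exact ⟨hf, ⟨X', hX.mem⟩, ⟨Y', hY.mem⟩, ObjectProperty.homMk ηX, ObjectProperty.homMk ηY,
      ObjectProperty.homMk f', isReflection_hom_iff.2 hX, isReflection_hom_iff.2 hY,
      isPullback_of_hom hp⟩

lemma isPullback_hom (hL : L.IsAdmissible) {P X Y₀ Y : L.Ext} {x : P ⟶ X} {f₀ : P ⟶ Y₀}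
    {f : X ⟶ Y} {y : Y₀ ⟶ Y} (hf : L.E f) (h : IsPullback x f₀ f y) :
    IsPullback x.hom f₀.hom f.hom y.hom := by
  have := hL.hasPullbacks
  have H := hL.extClass
  exact HigherCentral.isPullback_hom h
    (H.source (H.of_isPullback (IsPullback.of_hasPullback _ _) hf Y₀.property))

lemma isNormal_iff (hL : L.IsAdmissible) {X Y : L.Ext} {f : X ⟶ Y} :
    L.IsNormal f ↔ NormalExt L.isExt L.isSuccExt L.isCExt f.hom := by
  constructor
  · rintro ⟨hf, R, π₁, π₂, hR, hπ⟩
    exact ⟨hf, _, _, _, hL.isPullback_hom hf hR, hL.isTrivial_iff.1 hπ⟩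
  · rintro ⟨hf, R, π₁, π₂, hR, hπ⟩
    exact ⟨hf, ⟨R, hL.extClass.source hπ.1⟩, ObjectProperty.homMk π₁, ObjectProperty.homMk π₂,
      isPullback_of_hom hR, hL.isTrivial_iff.2 hπ⟩

lemma isCentral_iff_isNormal (hL : L.IsAdmissible) {X Y : L.Ext} {f : X ⟶ Y} :
    L.IsCentral f ↔ L.IsNormal f := by
  have := hL.hasPullbacks
  have := hL.hasZeroObject
  constructor
  · rintro ⟨hf, Y₀, X₀, a, f₀, x, ha, hp, hf₀⟩
    exact hL.isNormal_iff.2 (normalExt_of_isPullback hL.extClass hL.stronglyBirkhoff hf ha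
      (hL.isPullback_hom hf hp) (hL.isTrivial_iff.1 hf₀))
  · rintro ⟨hf, R, π₁, π₂, hR, hπ⟩
    exact ⟨hf, X, R, f, π₁, π₂, hf, hR.flip, hπ⟩

lemma isTrivial_of_isNormal (hL : L.IsAdmissible) {X Y : L.Ext} {f : X ⟶ Y} (hf : L.IsNormal f)
    (h : IsSplitEpi f) : L.IsTrivial f := by
  have := hL.hasPullbacks
  have := hL.hasZeroObject
  exact hL.isTrivial_iff.2 ((hL.isNormal_iff.1 hf).trivialExt_of_section hL.extClass
    hL.stronglyBirkhoff (congr_arg (·.hom) (IsSplitEpi.id f)))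

lemma next {L : Level.{max u v, v}} (hL : L.IsAdmissible) : L.next.IsAdmissible := by
  have := hL.hasPullbacks
  have := hL.hasZeroObject
  have e : L.next.isCExt = fun f : Arrow L.Arr =>
      NormalExt L.isExt L.isSuccExt L.isCExt f.hom := by
    funext f
    refine propext ⟨fun ⟨hl, hr, h⟩ => hL.isNormal_iff.1 h, fun h =>
      ⟨hL.extClass.source h.1, hL.extClass.target h.1, hL.isNormal_iff.2 h⟩⟩
  exact ⟨inferInstanceAs (HasPullbacks (Arrow L.Arr)),
    inferInstanceAs (HasZeroObject (Arrow L.Arr)), hL.extClass.squareExt,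
    e ▸ hL.stronglyBirkhoff.normalExt hL.extClass⟩

end IsAdmissible

lemma isAdmissible_first {A : Type u} [Category.{v} A] [SemiAbelian A] {B : ObjectProperty A}
    (hB : IsBirkhoff B) : (first B).IsAdmissible := by
  have H := extClass_regularEpi A
  have HB := hB.stronglyBirkhoff
  have hR := HigherCentral.nonempty_reflective hB.exists_isReflection
  have e : (first B).isCExt = fun f : Arrow A =>
      NormalExt (fun _ => True) (MorphismProperty.regularEpi A) B f.hom := by
    funext f
    refine propext ⟨fun ⟨hf, Y₀, X₀, a, f₀, x, ha, hp, hf₀⟩ => ?_,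
      fun ⟨hf, R, π₁, π₂, hp, hπ⟩ => ?_⟩
    · exact normalExt_of_isPullback H HB hf ha hp ((isTrivialExt_iff hR).1 hf₀)
    · exact ⟨hf, _, R, f.hom, π₁, π₂, hf, hp.flip, (isTrivialExt_iff hR).2 hπ⟩
  exact ⟨inferInstanceAs (HasPullbacks (Arrow A)), inferInstanceAs (HasZeroObject (Arrow A)),
    H.squareExt, e ▸ HB.normalExt H⟩

end Level

lemma isAdmissible_level {A : Type u} [Category.{v} A] [SemiAbelian A] {B : ObjectProperty A}
    (hB : IsBirkhoff B) : ∀ m : ℕ, (level B m).IsAdmissible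
  | 0 => Level.isAdmissible_first hB
  | m + 1 => (isAdmissible_level hB m).next

end HigherCentral

/-- With `n = m + 1 ≥ 1` and `Γ` the Galois structure `Γ_n` of `n`-fold extensions and central
`n`-fold extensions in a semi-abelian category `A` with Birkhoff subcategory `B`. -/
theorem proposition4p4 {A : Type u} [Category.{v} A] [HigherCentral.SemiAbelian A]
    (B : ObjectProperty A) (hB : HigherCentral.IsBirkhoff B) (m : ℕ) :
    -- `CExt^n_B A` is a reflective subcategory of `Ext^n A`
    Nonempty (Reflective (HigherCentral.level B m).cExt.ι) ∧
    -- central and normal extensions with respect to `Γ_n` coincide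
    (∀ {X Y : (HigherCentral.level B m).Ext} (f : X ⟶ Y),
      (HigherCentral.level B m).IsCentral f ↔ (HigherCentral.level B m).IsNormal f) ∧
    -- the objects of `CExt^{n+1}_B A` are exactly the extensions central with respect to `Γ_n`
    (∀ f : Arrow (HigherCentral.level B m).Arr,
      (HigherCentral.level B (m + 1)).isCExt f ↔
        ∃ (hl : (HigherCentral.level B m).isExt f.left)
          (hr : (HigherCentral.level B m).isExt f.right),
          (HigherCentral.level B m).IsCentral (X := ⟨f.left, hl⟩) (Y := ⟨f.right, hr⟩)
            (ObjectProperty.homMk f.hom)) ∧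
    -- every central extension that is a split epimorphism is trivial
    (∀ {X Y : (HigherCentral.level B m).Ext} (f : X ⟶ Y),
      (HigherCentral.level B m).IsCentral f → IsSplitEpi f →
        (HigherCentral.level B m).IsTrivial f) := by
  have h := HigherCentral.isAdmissible_level hB m
  refine ⟨h.nonempty_reflective, fun f => h.isCentral_iff_isNormal, fun f => ?_,
    fun f hf hs => h.isTrivial_of_isNormal (h.isCentral_iff_isNormal.1 hf) hs⟩
  exact exists_congr fun hl => exists_congr fun hr => h.isCentral_iff_isNormal.symm
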